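/- Conventions. All groupoids are étale topological groupoids: spaces $\mathcal G$ of arrows and $\mathcal G^0$ of objects, with continuous multiplication, units and inversion, and with range and source maps $r,s$ that are local homeomorphisms; no separation or local compactness is assumed. Such a groupoid is \emph{locally compact} if $\mathcal G^0$ is Hausdorff and locally compact. A \emph{groupoid correspondence} $\mathcal X\colon\mathcal H\leftarrow\mathcal G$ is a space with commuting continuous actions of $\mathcal H$ on the left (anchor map $r$) and of $\mathcal G$ on the right (anchor map $s$), such that $s\colon\mathcal X\to\mathcal G^0$ is a local homeomorphism and the right action is basic, that is, $(\gamma,g)\mapsto(\gamma g,\gamma)$ is a homeomorphism from $\mathcal X\times_{s,\mathcal G^0,r}\mathcal G$ onto its image in $\mathcal X\times\mathcal X$. It is \emph{proper} if the map $\mathcal X/\mathcal G\to\mathcal H^0$ induced by $r$ is proper (continuous and universally closed), and \emph{locally compact} if $\mathcal H$ and $\mathcal G$ are locally compact and $\mathcal X/\mathcal G$ is Hausdorff. The composite $\mathcal X\circ_{\mathcal G}\mathcal Y$ is the orbit space of $\mathcal X\times_{s,\mathcal G^0,r}\mathcal Y$ by the diagonal $\mathcal G$-action. Let $\mathcal C$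 be a small category. A \emph{$\mathcal C$-shaped diagram} $F$ of groupoid correspondences is a bicategory homomorphism from $\mathcal C$ to groupoid correspondences. It consists of groupoids $\mathcal G_x$ for objects $x$, correspondences $\mathcal X_g\colon\mathcal G_{x'}\leftarrow\mathcal G_x$ for arrows $g\colon x'\leftarrow x$, and biequivariant homeomorphisms $\mu_{g,h}\colon\mathcal X_g\circ\mathcal X_h\to\mathcal X_{gh}$ for composable arrows, such that $\mathcal X_{1_x}$ is (identified with) the identity correspondence $\mathcal G_x$, multiplication with identity correspondences is given by the actions of $\mathcal G_{x'}$ and $\mathcal G_x$ on $\mathcal X_g$, and the maps $\mu$ are associative. It is \emph{proper} (\emph{locally compact}) if all $\mathcal X_g$ (all $\mathcal G_x$ and $\mathcal X_g$) are. Put $\mathcal G^0:=\bigsqcup_x\mathcal G_x^0$. An \emph{$F$-action} on a space $Y$ consists of a partition $Y=\bigsqcup_x Y_x$ into clopen subsets, continuous maps $r\colon Y_x\to\mathcal G_x^0$ (together, a continuous map $r\colon Y\to\mathcal G^0$), and open, continuous, surjective maps $\mathcal X_g\times_{s,\mathcal G_x^0,r}Y_x\to Y_{x'}$, $(\gamma,y)\mapsto\gamma\cdot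 y$, for arrows $g\colon x'\leftarrow x$, such that $r(\gamma\cdot y)=r(\gamma)$; $\gamma_1\cdot(\gamma_2\cdot y)=\mu[\gamma_1,\gamma_2]\cdot y$ whenever this makes sense; and if $\gamma\cdot y=\gamma'\cdot y'$ with $\gamma,\gamma'\in\mathcal X_g$ and $y,y'\in Y_x$, then there is $\eta\in\mathcal G_x$ with $\gamma'=\gamma\eta$ and $y=\eta\cdot y'$. An \emph{$F$-equivariant map} is a continuous map that intertwines the maps to $\mathcal G^0$ and the multiplications. An $F$-action $\Omega$ is \emph{universal} if every $F$-action has a unique $F$-equivariant map to it. A \emph{groupoid model} of $F$ is an étale groupoid $\mathcal U$ with natural bijections between the sets of $\mathcal U$-actions and $F$-actions on $Y$, for all spaces $Y$; naturality means that a continuous map is $\mathcal U$-equivariant if and only if it is $F$-equivariant for the corresponding $F$-actions. Theorem. Let $F$ be a proper, locally compact diagram of groupoid correspondences. Then $F$ has a universal action, and the space $\Omega$ of any universal $F$-action is Hausdorff and locally compact, and the map $\Omega\to\mathcal G^0$ is proper. Moreover, $F$ has a groupoid model, and any groupoid model of $F$ is a locally compact étale groupoid. -/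

import Mathlib

open CategoryTheory Topology

universe u

/-- An étale topological groupoid: spaces of objects and arrows, continuous range and source maps
that are local homeomorphisms, a continuous multiplication `g · h` defined when `s g = r h`,
continuous units and inverses. The spaces need not be Hausdorff or locally compact. -/
structure EtaleGroupoid where
  Obj : Type u
  Arr : Type u
  [topObj : TopologicalSpace Obj]
  [topArr : TopologicalSpace Arr]
  r : Arr → Obj
  s : Arr → Obj
  mul : (g h : Arr) → s g = r h → Arr
  unit : Obj → Arr
  inv : Arr → Arr
  r_mul : ∀ g h e, r (mul g h e) = r g
  s_mul : ∀ g h e, s (mul g h e) = s h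
  mul_assoc : ∀ g h k (e : s g = r h) (e' : s h = r k),
    mul (mul g h e) k ((s_mul g h e).trans e') = mul g (mul h k e') (e.trans (r_mul h k e').symm)
  r_unit : ∀ b, r (unit b) = b
  s_unit : ∀ b, s (unit b) = b
  unit_mul : ∀ g, mul (unit (r g)) g (s_unit (r g)) = g
  mul_unit : ∀ g, mul g (unit (s g)) (r_unit (s g)).symm = g
  r_inv : ∀ g, r (inv g) = s g
  s_inv : ∀ g, s (inv g) = r g
  inv_mul : ∀ g, mul (inv g) g (s_inv g) = unit (s g)
  mul_inv : ∀ g, mul g (inv g) (r_inv g).symm = unit (r g)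
  continuous_mul : Continuous fun p : {p : Arr × Arr // s p.1 = r p.2} => mul p.1.1 p.1.2 p.2
  continuous_unit : Continuous unit
  continuous_inv : Continuous inv
  isLocalHomeomorph_r : IsLocalHomeomorph r
  isLocalHomeomorph_s : IsLocalHomeomorph s

attribute [instance] EtaleGroupoid.topObj EtaleGroupoid.topArr

namespace EtaleGroupoid

/-- An étale groupoid is locally compact if its object space is Hausdorff and locally compact. -/
def IsLocallyCompact (G : EtaleGroupoid.{u}) : Prop :=
  T2Space G.Obj ∧ LocallyCompactSpace G.Obj

/-- A (continuous) left action of an étale groupoid on a topological space. -/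
structure LeftAction (G : EtaleGroupoid.{u}) (Y : Type u) [TopologicalSpace Y] where
  anchor : Y → G.Obj
  act : (g : G.Arr) → (y : Y) → G.s g = anchor y → Y
  anchor_act : ∀ g y e, anchor (act g y e) = G.r g
  mul_act : ∀ g h y (e : G.s g = G.r h) (e' : G.s h = anchor y),
    act (G.mul g h e) y ((G.s_mul g h e).trans e') =
      act g (act h y e') (e.trans (anchor_act h y e').symm)
  unit_act : ∀ y, act (G.unit (anchor y)) y (G.s_unit (anchor y)) = y
  continuous_anchor : Continuous anchor
  continuous_act : Continuous fun p : {p : G.Arr × Y // G.s p.1 = anchor p.2} =>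
    act p.1.1 p.1.2 p.2

/-- A (continuous) right action of an étale groupoid on a topological space. -/
structure RightAction (G : EtaleGroupoid.{u}) (Y : Type u) [TopologicalSpace Y] where
  anchor : Y → G.Obj
  act : (y : Y) → (g : G.Arr) → anchor y = G.r g → Y
  anchor_act : ∀ y g e, anchor (act y g e) = G.s g
  act_mul : ∀ y g h (e : anchor y = G.r g) (e' : G.s g = G.r h),
    act y (G.mul g h e') (e.trans (G.r_mul g h e').symm) =
      act (act y g e) h ((anchor_act y g e).trans e')
  act_unit : ∀ y, act y (G.unit (anchor y)) (G.r_unit (anchor y)).symm = y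
  continuous_anchor : Continuous anchor
  continuous_act : Continuous fun p : {p : Y × G.Arr // anchor p.1 = G.r p.2} =>
    act p.1.1 p.1.2 p.2

/-- Equivariant continuous maps between spaces with left actions of `G`. -/
def LeftAction.IsEquivariant {G : EtaleGroupoid.{u}} {Y Y' : Type u} [TopologicalSpace Y]
    [TopologicalSpace Y'] (a : G.LeftAction Y) (a' : G.LeftAction Y') (φ : Y → Y') : Prop :=
  Continuous φ ∧ ∃ hanchor : ∀ y, a'.anchor (φ y) = a.anchor y,
    ∀ (g : G.Arr) (y : Y) (e : G.s g = a.anchor y),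
      φ (a.act g y e) = a'.act g (φ y) (e.trans (hanchor y).symm)

/-- A right action is basic if `(y, g) ↦ (y · g, y)` is a homeomorphism onto its image. -/
def RightAction.IsBasic {G : EtaleGroupoid.{u}} {Y : Type u} [TopologicalSpace Y]
    (a : G.RightAction Y) : Prop :=
  IsEmbedding fun p : {p : Y × G.Arr // a.anchor p.1 = G.r p.2} =>
    ((a.act p.1.1 p.1.2 p.2, p.1.1) : Y × Y)

/-- The orbit relation of a right action. -/
def RightAction.orbitSetoid {G : EtaleGroupoid.{u}} {Y : Type u} [TopologicalSpace Y]
    (a : G.RightAction Y) : Setoid Y where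
  r y y' := ∃ (g : G.Arr) (e : a.anchor y = G.r g), a.act y g e = y'
  iseqv :=
    { refl := fun y => ⟨_, _, a.act_unit y⟩
      symm := by
        rintro y _ ⟨g, e, rfl⟩
        refine ⟨G.inv g, (a.anchor_act y g e).trans (G.r_inv g).symm, ?_⟩
        rw [← a.act_mul y g (G.inv g) e (G.r_inv g).symm]
        have key : ∀ k (hk : k = G.unit (a.anchor y)) (hy : a.anchor y = G.r k),
            a.act y k hy = y := by
          rintro k rfl hy
          exact a.act_unit y
        exact key _ ((G.mul_inv g).trans (congrArg G.unit e.symm)) _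
      trans := by
        rintro y _ _ ⟨g, e, rfl⟩ ⟨h, e', rfl⟩
        exact ⟨_, _, a.act_mul y g h e ((a.anchor_act y g e).symm.trans e')⟩ }

/-- The orbit space `Y / G` (with the quotient topology). -/
def RightAction.OrbitSpace {G : EtaleGroupoid.{u}} {Y : Type u} [TopologicalSpace Y]
    (a : G.RightAction Y) : Type u :=
  Quotient a.orbitSetoid

instance RightAction.instTopologicalSpaceOrbitSpace {G : EtaleGroupoid.{u}} {Y : Type u}
    [TopologicalSpace Y] (a : G.RightAction Y) : TopologicalSpace a.OrbitSpace :=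
  inferInstanceAs (TopologicalSpace (Quotient a.orbitSetoid))

end EtaleGroupoid

/-- An étale groupoid correspondence `H ← G`: a space with commuting actions of `H` on the left and
`G` on the right, such that the right anchor map is a local homeomorphism and the right action is
basic. -/
structure GroupoidCorrespondence (H G : EtaleGroupoid.{u}) where
  carrier : Type u
  [top : TopologicalSpace carrier]
  left : H.LeftAction carrier
  right : G.RightAction carrier
  right_anchor_left : ∀ h γ e, right.anchor (left.act h γ e) = right.anchor γ
  left_anchor_right : ∀ γ g e, left.anchor (right.act γ g e) = left.anchor γ
  act_comm : ∀ h γ g (e : H.s h = left.anchor γ) (e' : right.anchor γ = G.r g),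
    right.act (left.act h γ e) g ((right_anchor_left h γ e).trans e') =
      left.act h (right.act γ g e') (e.trans (left_anchor_right γ g e').symm)
  isLocalHomeomorph_right_anchor : IsLocalHomeomorph right.anchor
  isBasic : right.IsBasic

attribute [instance] GroupoidCorrespondence.top

namespace GroupoidCorrespondence

variable {H G K : EtaleGroupoid.{u}}

instance : CoeSort (GroupoidCorrespondence H G) (Type u) :=
  ⟨GroupoidCorrespondence.carrier⟩

/-- The left anchor map `r`. -/
def r (X : GroupoidCorrespondence H G) (γ : X) : H.Obj :=
  X.left.anchor γ

/-- The right anchor map `s`. -/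
def s (X : GroupoidCorrespondence H G) (γ : X) : G.Obj :=
  X.right.anchor γ

/-- The map `X / G → H⁰` induced by the left anchor map. -/
def orbitAnchor (X : GroupoidCorrespondence H G) : X.right.OrbitSpace → H.Obj :=
  Quotient.lift X.r (by
    rintro γ _ ⟨g, e, rfl⟩
    exact (X.left_anchor_right γ g e).symm)

/-- A correspondence is proper if the induced map `X / G → H⁰` is proper. -/
def IsProper (X : GroupoidCorrespondence H G) : Prop :=
  IsProperMap X.orbitAnchor

/-- A correspondence between locally compact groupoids is locally compact if its orbit space
`X / G` is Hausdorff. -/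
def IsLocallyCompact (X : GroupoidCorrespondence H G) : Prop :=
  H.IsLocallyCompact ∧ G.IsLocallyCompact ∧ T2Space X.right.OrbitSpace

/-- The fibre product over `G⁰` of two composable correspondences. -/
def FibreProduct (X : GroupoidCorrespondence H G) (Y : GroupoidCorrespondence G K) : Type u :=
  {p : X × Y // X.s p.1 = Y.r p.2}

instance (X : GroupoidCorrespondence H G) (Y : GroupoidCorrespondence G K) :
    TopologicalSpace (X.FibreProduct Y) :=
  inferInstanceAs (TopologicalSpace {p : X × Y // X.s p.1 = Y.r p.2})

/-- The equivalence relation on the fibre product generated by `(γ · g, δ) ∼ (γ, g · δ)`, that is,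
the orbit relation of the diagonal action of `G`. -/
def compSetoid (X : GroupoidCorrespondence H G) (Y : GroupoidCorrespondence G K) :
    Setoid (X.FibreProduct Y) where
  r p q := ∃ (g : G.Arr) (e : X.s p.1.1 = G.r g) (e' : G.s g = Y.r q.1.2),
    q.1.1 = X.right.act p.1.1 g e ∧ p.1.2 = Y.left.act g q.1.2 e'
  iseqv :=
    { refl := by
        rintro ⟨⟨x, y⟩, hxy⟩
        refine ⟨G.unit (X.s x), (G.r_unit _).symm, (G.s_unit _).trans hxy,
          (X.right.act_unit x).symm, ?_⟩
        have key : ∀ b (hb : b = Y.r y) (h : G.s (G.unit b) = Y.r y),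
            y = Y.left.act (G.unit b) y h := by
          rintro b rfl h
          exact (Y.left.unit_act y).symm
        exact key _ hxy _
      symm := by
        rintro ⟨⟨x, y⟩, hxy⟩ ⟨⟨x', y'⟩, hxy'⟩ ⟨g, e, e', h1, h2⟩
        dsimp only at e e' h1 h2 hxy hxy'
        subst h1 h2
        refine ⟨G.inv g, (X.right.anchor_act x g e).trans (G.r_inv g).symm,
          (G.s_inv g).trans (Y.left.anchor_act g y' e').symm, ?_, ?_⟩
        · have key : ∀ k (hk : k = G.unit (X.s x)) (h : X.s x = G.r k),
              x = X.right.act x k h := by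
            rintro k rfl h
            exact (X.right.act_unit x).symm
          exact (key _ ((G.mul_inv g).trans (congrArg G.unit e.symm)) _).trans
            (X.right.act_mul x g (G.inv g) e (G.r_inv g).symm)
        · have key : ∀ k (hk : k = G.unit (Y.r y')) (h : G.s k = Y.r y'),
              y' = Y.left.act k y' h := by
            rintro k rfl h
            exact (Y.left.unit_act y').symm
          exact (key _ ((G.inv_mul g).trans (congrArg G.unit e')) _).trans
            (Y.left.mul_act (G.inv g) g y' (G.s_inv g) e')
      trans := by
        rintro ⟨⟨x, y⟩, hxy⟩ ⟨⟨x', y'⟩, hxy'⟩ ⟨⟨x'', y''⟩, hxy''⟩ ⟨g, e, e', h1, h2⟩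
          ⟨k, f, f', h3, h4⟩
        dsimp only at e e' h1 h2 f f' h3 h4 hxy hxy' hxy''
        subst h1 h2 h3 h4
        have hgk : G.s g = G.r k := (X.right.anchor_act x g e).symm.trans f
        exact ⟨G.mul g k hgk, e.trans (G.r_mul g k hgk).symm, (G.s_mul g k hgk).trans f',
          (X.right.act_mul x g k e hgk).symm, (Y.left.mul_act g k y'' hgk f').symm⟩ }

/-- The underlying space of the composite correspondence `X ∘_G Y`: the orbit space of the fibre
product by the diagonal `G`-action, with the quotient topology. -/
def Comp (X : GroupoidCorrespondence H G) (Y : GroupoidCorrespondence G K) : Type u :=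
  Quotient (X.compSetoid Y)

instance (X : GroupoidCorrespondence H G) (Y : GroupoidCorrespondence G K) :
    TopologicalSpace (X.Comp Y) :=
  inferInstanceAs (TopologicalSpace (Quotient (X.compSetoid Y)))

/-- The class `[γ, δ]` in `X ∘_G Y`. Its anchors are `r γ` and `s δ`; the left and right actions
are `h · [γ, δ] = [h · γ, δ]` and `[γ, δ] · k = [γ, δ · k]`. -/
def Comp.mk {X : GroupoidCorrespondence H G} {Y : GroupoidCorrespondence G K} (γ : X) (δ : Y)
    (e : X.s γ = Y.r δ) : X.Comp Y :=
  Quotient.mk (X.compSetoid Y) ⟨(γ, δ), e⟩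

end GroupoidCorrespondence

/-- A `C`-shaped diagram of groupoid correspondences, that is, a bicategory homomorphism from `C`
to the bicategory of étale groupoids and groupoid correspondences.

An arrow `g : x ⟶ y` is sent to a correspondence `X g : Gr y ← Gr x`. The multiplication map for
`g : y ⟶ z` and `h : x ⟶ y` goes from `X g ∘ X h` to `X (h ≫ g)`; it is indexed by an extra arrow
`k` with `h ≫ g = k`, so that associativity can be stated without transport along equalities of
arrows. -/
structure CorrespondenceDiagram (C : Type u) [SmallCategory C] where
  /-- the groupoids -/
  Gr : C → EtaleGroupoid.{u}
  /-- the correspondences -/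
  X : ∀ {x y : C}, (x ⟶ y) → GroupoidCorrespondence (Gr y) (Gr x)
  /-- the identification of the identity correspondence on `Gr x` with `X (𝟙 x)` -/
  one : ∀ x : C, (Gr x).Arr ≃ₜ X (𝟙 x)
  /-- the multiplication homeomorphisms -/
  mul : ∀ {x y z : C} (g : y ⟶ z) (h : x ⟶ y) (k : x ⟶ z), h ≫ g = k →
    (X g).Comp (X h) ≃ₜ X k
  -- `one` is an isomorphism of correspondences
  r_one : ∀ x η, (X (𝟙 x)).r (one x η) = (Gr x).r η
  s_one : ∀ x η, (X (𝟙 x)).s (one x η) = (Gr x).s η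
  one_left : ∀ x η ζ (e : (Gr x).s η = (Gr x).r ζ),
    one x ((Gr x).mul η ζ e) = (X (𝟙 x)).left.act η (one x ζ) (e.trans (r_one x ζ).symm)
  one_right : ∀ x η ζ (e : (Gr x).s η = (Gr x).r ζ),
    one x ((Gr x).mul η ζ e) = (X (𝟙 x)).right.act (one x η) ζ ((s_one x η).trans e)
  -- `mul` is an isomorphism of correspondences
  r_mul : ∀ {x y z : C} (g : y ⟶ z) (h : x ⟶ y) (k : x ⟶ z) (hk : h ≫ g = k)
    (γ : X g) (δ : X h) (e : (X g).s γ = (X h).r δ),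
    (X k).r (mul g h k hk (.mk γ δ e)) = (X g).r γ
  s_mul : ∀ {x y z : C} (g : y ⟶ z) (h : x ⟶ y) (k : x ⟶ z) (hk : h ≫ g = k)
    (γ : X g) (δ : X h) (e : (X g).s γ = (X h).r δ),
    (X k).s (mul g h k hk (.mk γ δ e)) = (X h).s δ
  mul_left : ∀ {x y z : C} (g : y ⟶ z) (h : x ⟶ y) (k : x ⟶ z) (hk : h ≫ g = k)
    (η : (Gr z).Arr) (γ : X g) (δ : X h) (e : (X g).s γ = (X h).r δ)
    (e' : (Gr z).s η = (X g).r γ),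
    mul g h k hk (.mk ((X g).left.act η γ e') δ (((X g).right_anchor_left η γ e').trans e)) =
      (X k).left.act η (mul g h k hk (.mk γ δ e)) (e'.trans (r_mul g h k hk γ δ e).symm)
  mul_right : ∀ {x y z : C} (g : y ⟶ z) (h : x ⟶ y) (k : x ⟶ z) (hk : h ≫ g = k)
    (γ : X g) (δ : X h) (η : (Gr x).Arr) (e : (X g).s γ = (X h).r δ)
    (e' : (X h).s δ = (Gr x).r η),
    mul g h k hk (.mk γ ((X h).right.act δ η e') (e.trans ((X h).left_anchor_right δ η e').symm)) =
      (X k).right.act (mul g h k hk (.mk γ δ e)) η ((s_mul g h k hk γ δ e).trans e')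
  -- multiplication with identity correspondences is the canonical isomorphism
  mul_one : ∀ {x y : C} (g : x ⟶ y) (γ : X g) (η : (Gr x).Arr) (e : (X g).s γ = (Gr x).r η),
    mul g (𝟙 x) g (Category.id_comp g) (.mk γ (one x η) (e.trans (r_one x η).symm)) =
      (X g).right.act γ η e
  one_mul : ∀ {x y : C} (g : x ⟶ y) (η : (Gr y).Arr) (γ : X g) (e : (Gr y).s η = (X g).r γ),
    mul (𝟙 y) g g (Category.comp_id g) (.mk (one y η) γ ((s_one y η).trans e)) =
      (X g).left.act η γ e
  -- coherence with the associator `[[γ₁, γ₂], γ₃] ↦ [γ₁, [γ₂, γ₃]]`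
  mul_assoc : ∀ {x₀ x₁ x₂ x₃ : C} (g₀₁ : x₁ ⟶ x₀) (g₁₂ : x₂ ⟶ x₁) (g₂₃ : x₃ ⟶ x₂)
    (g₀₂ : x₂ ⟶ x₀) (g₁₃ : x₃ ⟶ x₁) (g₀₃ : x₃ ⟶ x₀)
    (h₀₂ : g₁₂ ≫ g₀₁ = g₀₂) (h₁₃ : g₂₃ ≫ g₁₂ = g₁₃)
    (h₀₃ : g₂₃ ≫ g₀₂ = g₀₃) (h₀₃' : g₁₃ ≫ g₀₁ = g₀₃)
    (γ₁ : X g₀₁) (γ₂ : X g₁₂) (γ₃ : X g₂₃)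
    (e : (X g₀₁).s γ₁ = (X g₁₂).r γ₂) (e' : (X g₁₂).s γ₂ = (X g₂₃).r γ₃),
    mul g₀₂ g₂₃ g₀₃ h₀₃ (.mk (mul g₀₁ g₁₂ g₀₂ h₀₂ (.mk γ₁ γ₂ e)) γ₃
        ((s_mul g₀₁ g₁₂ g₀₂ h₀₂ γ₁ γ₂ e).trans e')) =
      mul g₀₁ g₁₃ g₀₃ h₀₃' (.mk γ₁ (mul g₁₂ g₂₃ g₁₃ h₁₃ (.mk γ₂ γ₃ e'))
        (e.trans (r_mul g₁₂ g₂₃ g₁₃ h₁₃ γ₂ γ₃ e').symm))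

namespace CorrespondenceDiagram

variable {C : Type u} [SmallCategory C] (F : CorrespondenceDiagram C)

/-- A diagram is proper if all its correspondences are proper. -/
def IsProper : Prop :=
  ∀ {x y : C} (g : x ⟶ y), (F.X g).IsProper

/-- A diagram is locally compact if all its groupoids and correspondences are locally compact. -/
def IsLocallyCompact : Prop :=
  (∀ x : C, (F.Gr x).IsLocallyCompact) ∧ ∀ {x y : C} (g : x ⟶ y), (F.X g).IsLocallyCompact

/-- The space `Gr⁰ = ⨆ₓ Grₓ⁰`, with the disjoint union topology. -/
abbrev ObjSpace : Type u :=
  Σ x : C, (F.Gr x).Obj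

/-- An `F`-action on a space `Y`.

The partition of `Y` into clopen subsets `Y x` and the continuous maps `r : Y x → Grₓ⁰` are
assembled into one continuous map `anchor : Y → ⨆ₓ Grₓ⁰`: `anchor y = ⟨x, b⟩` means that `y` belongs
to `Y x` and `r y = b`. For each arrow `g : x ⟶ x'`, the map `act g` is defined on the fibre product
of `X g` and `Y x` over `Grₓ⁰`; it takes values in the clopen subset `Y x'`. -/
structure Action (Y : Type u) [TopologicalSpace Y] where
  anchor : Y → F.ObjSpace
  continuous_anchor : Continuous anchor
  act : ∀ {x x' : C} (g : x ⟶ x') (γ : F.X g) (y : Y), anchor y = ⟨x, (F.X g).s γ⟩ → Y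
  anchor_act : ∀ {x x' : C} (g : x ⟶ x') (γ : F.X g) (y : Y) (e : anchor y = ⟨x, (F.X g).s γ⟩),
    anchor (act g γ y e) = ⟨x', (F.X g).r γ⟩
  continuous_act : ∀ {x x' : C} (g : x ⟶ x'),
    Continuous fun p : {p : F.X g × Y // anchor p.2 = ⟨x, (F.X g).s p.1⟩} => act g p.1.1 p.1.2 p.2
  isOpenMap_act : ∀ {x x' : C} (g : x ⟶ x'),
    IsOpenMap fun p : {p : F.X g × Y // anchor p.2 = ⟨x, (F.X g).s p.1⟩} => act g p.1.1 p.1.2 p.2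
  /-- `act g` is surjective onto `Y x'` -/
  surjective_act : ∀ {x x' : C} (g : x ⟶ x') (y' : Y), (anchor y').1 = x' →
    ∃ (γ : F.X g) (y : Y) (e : anchor y = ⟨x, (F.X g).s γ⟩), act g γ y e = y'
  mul_act : ∀ {x y z : C} (g : y ⟶ z) (h : x ⟶ y) (k : x ⟶ z) (hk : h ≫ g = k)
    (γ₁ : F.X g) (γ₂ : F.X h) (w : Y) (e : (F.X g).s γ₁ = (F.X h).r γ₂)
    (e' : anchor w = ⟨x, (F.X h).s γ₂⟩),
    act g γ₁ (act h γ₂ w e') ((anchor_act h γ₂ w e').trans (congrArg (Sigma.mk y) e.symm)) =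
      act k (F.mul g h k hk (.mk γ₁ γ₂ e)) w
        (e'.trans (congrArg (Sigma.mk x) (F.s_mul g h k hk γ₁ γ₂ e).symm))
  /-- if `γ · y = γ' · y'`, there is `η` in `Gr x` with `γ' = γ · η` and `y = η · y'` -/
  exists_of_act_eq : ∀ {x x' : C} (g : x ⟶ x') (γ γ' : F.X g) (y y' : Y)
    (e : anchor y = ⟨x, (F.X g).s γ⟩) (e' : anchor y' = ⟨x, (F.X g).s γ'⟩),
    act g γ y e = act g γ' y' e' →
      ∃ (η : (F.Gr x).Arr) (h : (F.X g).s γ = (F.Gr x).r η)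
        (h' : anchor y' = ⟨x, (F.X (𝟙 x)).s (F.one x η)⟩),
        γ' = (F.X g).right.act γ η h ∧ y = act (𝟙 x) (F.one x η) y' h'

variable {F}

/-- `F`-equivariant continuous maps. -/
def Action.IsEquivariant {Y Y' : Type u} [TopologicalSpace Y] [TopologicalSpace Y']
    (a : F.Action Y) (a' : F.Action Y') (φ : Y → Y') : Prop :=
  Continuous φ ∧ ∃ hanchor : ∀ y, a'.anchor (φ y) = a.anchor y,
    ∀ {x x' : C} (g : x ⟶ x') (γ : F.X g) (y : Y) (e : a.anchor y = ⟨x, (F.X g).s γ⟩),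
      φ (a.act g γ y e) = a'.act g γ (φ y) ((hanchor y).trans e)

/-- An `F`-action is universal if every `F`-action has a unique `F`-equivariant continuous map
to it. -/
def Action.IsUniversal {Ω : Type u} [TopologicalSpace Ω] (ω : F.Action Ω) : Prop :=
  ∀ (Y : Type u) [TopologicalSpace Y] (a : F.Action Y), ∃! φ : Y → Ω, a.IsEquivariant ω φ

variable (F)

/-- A groupoid model of `F` is an étale groupoid `U` with natural bijections between the sets of
`U`-actions and `F`-actions on `Y` for all spaces `Y`. Naturality means that the bijections identify
the `U`-equivariant and the `F`-equivariant continuous maps. -/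
def IsGroupoidModel (U : EtaleGroupoid.{u}) : Prop :=
  ∃ Φ : ∀ (Y : Type u) [TopologicalSpace Y], U.LeftAction Y ≃ F.Action Y,
    ∀ (Y Y' : Type u) [TopologicalSpace Y] [TopologicalSpace Y'] (a : U.LeftAction Y)
      (a' : U.LeftAction Y') (φ : Y → Y'),
      a.IsEquivariant a' φ ↔ (Φ Y a).IsEquivariant (Φ Y' a') φ

end CorrespondenceDiagram

/-! Slices cover each `X g`, because `s` is a local homeomorphism and the right action is basic. On
any `F`-action a slice acts by a partial homeomorphism, and so does every word in slices and formal
inverses. The code of a point records, for each word, the anchor of the image of the point, or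
nothing where the word is undefined. Codes are functions between fixed sets, so the codes of points
of all `F`-actions form a set, `CodeSpace`; this avoids a limit over a proper class. Two points have
the same code exactly when some bisimulation relates them (`IsBisimulation.code_eq`,
`isBisimulation_code_eq`), so codes inherit an `F`-action. Taking codes is equivariant, equivariant
maps preserve codes, and each code is its own code (`toCode_action`). Hence `CodeSpace` is
universal, for every diagram.

Properness and local compactness enter through ultrafilters along which the anchor map converges.
Such an ultrafilter `𝒰` can be multiplied by `γ` when its limit anchor is `s γ`. Properness of `X g`
writes every such ultrafilter over the codomain as some `γ · 𝒰`, and Hausdorff orbit spaces give the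
cancellation axiom. So these ultrafilters form an `F`-action, taken discrete, and have codes
themselves. Convergence to a point is a bisimulation, so a limit has the same code as the
ultrafilter; on `CodeSpace` the ultrafilter does converge to its code. Limits therefore exist and
are unique: the anchor map is proper and `CodeSpace` is Hausdorff. Local compactness is pulled back
along the proper anchor map.

The model is the groupoid of germs of words over `CodeSpace`. Two words have the same germ if they
act equally on all points, of all `F`-actions, with nearby codes; comparing them on `CodeSpace`
alone could lose isotropy. Its actions and `F`-actions determine each other. For an arbitrary model
`U`, the canonical action on `U.Obj` is terminal among `U`-actions, hence a universal `F`-action,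
and the results on universal actions apply. -/

theorem isOpenMap_snd_pullback {A B D : Type*} [TopologicalSpace A] [TopologicalSpace B]
    [TopologicalSpace D] {f : A → B} {g : D → B} (hf : Continuous f) (hg : IsOpenMap g) :
    IsOpenMap fun p : {p : D × A // f p.2 = g p.1} => p.1.2 := by
  intro W hW
  obtain ⟨W', hW', rfl⟩ := isOpen_induced_iff.mp hW
  rw [isOpen_iff_mem_nhds]
  rintro _ ⟨⟨⟨d, a⟩, e⟩, h, rfl⟩
  obtain ⟨V, U, hV, hU, hd, ha, hVU⟩ := isOpen_prod_iff.mp hW' d a h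
  have e' : f a = g d := e
  filter_upwards [hU.mem_nhds ha,
    (((hg V hV).preimage hf).mem_nhds (show f a ∈ g '' V from ⟨d, hd, e'.symm⟩))] with a' h1 h2
  obtain ⟨d', hd', h'⟩ := h2
  exact ⟨⟨(d', a'), h'.symm⟩, hVU ⟨hd', h1⟩, rfl⟩

/-! ### Basic actions and orbit spaces -/

namespace EtaleGroupoid

variable {G : EtaleGroupoid.{u}}

/-- The unit map is a section of the local homeomorphism `r`, hence itself a local homeomorphism. -/
theorem isOpen_range_unit (G : EtaleGroupoid.{u}) : IsOpen (Set.range G.unit) := by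
  have h : IsLocalHomeomorph G.unit := by
    refine IsLocalHomeomorph.of_comp (g := G.r) ?_ G.isLocalHomeomorph_r G.continuous_unit
    have : G.r ∘ G.unit = id := funext G.r_unit
    rw [this]
    exact (Homeomorph.refl _).isLocalHomeomorph
  exact h.isOpenMap.isOpen_range

theorem RightAction.act_unit' {Y : Type u} [TopologicalSpace Y] (a : G.RightAction Y)
    {y : Y} {g : G.Arr} (hg : g ∈ Set.range G.unit) (e : a.anchor y = G.r g) :
    a.act y g e = y := by
  obtain ⟨b, rfl⟩ := hg
  have hb : a.anchor y = b := e.trans (G.r_unit b)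
  subst hb
  exact a.act_unit y

/-- Basic actions are free: `g` and the unit give the same pair `(y, y)`, and the map to pairs is
injective. -/
theorem RightAction.IsBasic.eq_unit {Y : Type u} [TopologicalSpace Y] {a : G.RightAction Y}
    (h : a.IsBasic) {y : Y} {g : G.Arr} (e : a.anchor y = G.r g) (hy : a.act y g e = y) :
    g = G.unit (a.anchor y) := by
  have := @h.injective ⟨(y, g), e⟩ ⟨(y, G.unit (a.anchor y)), (G.r_unit _).symm⟩
    (by simp only [Prod.mk.injEq, and_true]; rw [hy, a.act_unit])
  exact congrArg (fun p => p.1.2) this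

/-- A set meets each orbit at most once. -/
def RightAction.OrbitInjOn {Y : Type u} [TopologicalSpace Y] (a : G.RightAction Y)
    (S : Set Y) : Prop :=
  ∀ y ∈ S, ∀ g e, a.act y g e ∈ S → a.act y g e = y

/-- Units are open among the arrows. By the embedding property, the pairs `(y · g, y)` with `g` a
unit are therefore open in the orbit relation, so a small square around `(y, y)` meets that relation
only in the diagonal. -/
theorem RightAction.IsBasic.exists_orbitInjOn {Y : Type u} [TopologicalSpace Y]
    {a : G.RightAction Y} (h : a.IsBasic) (y : Y) :
    ∃ S : Set Y, IsOpen S ∧ y ∈ S ∧ a.OrbitInjOn S := by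
  have ho : IsOpen {p : {p : Y × G.Arr // a.anchor p.1 = G.r p.2} | p.1.2 ∈ Set.range G.unit} :=
    G.isOpen_range_unit.preimage (continuous_snd.comp continuous_subtype_val)
  obtain ⟨W, hW, hWo⟩ := h.isOpen_iff.mp ho
  have hyW : (y, y) ∈ W := by
    have : (⟨(y, G.unit (a.anchor y)), (G.r_unit _).symm⟩ :
        {p : Y × G.Arr // a.anchor p.1 = G.r p.2}) ∈ (fun p : {p : Y × G.Arr // a.anchor p.1 =
          G.r p.2} => ((a.act p.1.1 p.1.2 p.2, p.1.1) : Y × Y)) ⁻¹' W := by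
      rw [hWo]; exact ⟨_, rfl⟩
    simpa [a.act_unit] using this
  obtain ⟨U, V, hU, hV, hyU, hyV, hUV⟩ := isOpen_prod_iff.mp hW y y hyW
  refine ⟨U ∩ V, hU.inter hV, ⟨hyU, hyV⟩, fun z hz g e hg => a.act_unit' ?_ e⟩
  have : (⟨(z, g), e⟩ : {p : Y × G.Arr // a.anchor p.1 = G.r p.2}) ∈ (fun p : {p : Y × G.Arr //
      a.anchor p.1 = G.r p.2} => ((a.act p.1.1 p.1.2 p.2, p.1.1) : Y × Y)) ⁻¹' W :=
    hUV ⟨hg.1, hz.2⟩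
  rw [hWo] at this
  exact this

theorem RightAction.isOpen_saturation {Y : Type u} [TopologicalSpace Y] (a : G.RightAction Y)
    {A : Set Y} (hA : IsOpen A) : IsOpen {y | ∃ g e, a.act y g e ∈ A} := by
  have h := isOpenMap_snd_pullback a.continuous_anchor G.isLocalHomeomorph_r.isOpenMap
  have hc : Continuous fun p : {p : G.Arr × Y // a.anchor p.2 = G.r p.1} =>
      a.act p.1.2 p.1.1 p.2 :=
    a.continuous_act.comp (Continuous.subtype_mk
      (continuous_swap.comp continuous_subtype_val) fun p => p.2)
  convert h _ (hA.preimage hc) using 1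
  ext y
  constructor
  · rintro ⟨g, e, hg⟩
    exact ⟨⟨(g, y), e⟩, hg, rfl⟩
  · rintro ⟨⟨⟨g, y⟩, e⟩, hg, rfl⟩
    exact ⟨g, e, hg⟩

/-- The orbit projection. -/
def RightAction.orbit {Y : Type u} [TopologicalSpace Y] (a : G.RightAction Y) (y : Y) :
    a.OrbitSpace :=
  Quotient.mk a.orbitSetoid y

theorem RightAction.orbit_eq_iff {Y : Type u} [TopologicalSpace Y] (a : G.RightAction Y)
    {y y' : Y} : a.orbit y = a.orbit y' ↔ ∃ g e, a.act y g e = y' :=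
  Quotient.eq (r := a.orbitSetoid)

theorem RightAction.continuous_orbit {Y : Type u} [TopologicalSpace Y] (a : G.RightAction Y) :
    Continuous a.orbit :=
  continuous_quotient_mk'

theorem RightAction.isOpenMap_orbit {Y : Type u} [TopologicalSpace Y] (a : G.RightAction Y) :
    IsOpenMap a.orbit := by
  intro A hA
  refine isOpen_coinduced.mpr ?_
  convert a.isOpen_saturation hA using 1
  ext y
  constructor
  · rintro ⟨z, hz, h⟩
    obtain ⟨g, e, h⟩ := a.orbit_eq_iff.mp (h.symm : a.orbit y = a.orbit z)
    exact ⟨g, e, h ▸ hz⟩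
  · rintro ⟨g, e, h⟩
    exact ⟨_, h, (a.orbit_eq_iff.mpr ⟨g, e, rfl⟩).symm⟩

end EtaleGroupoid

/-! ### Slices and words in slices -/

namespace CorrespondenceDiagram

variable {C : Type u} [SmallCategory C] {F : CorrespondenceDiagram C}

/-- A slice of one of the correspondences of `F`: an open subset on which both the right anchor
map and the orbit projection are injective. -/
structure Slice (F : CorrespondenceDiagram C) where
  {dom cod : C}
  hom : dom ⟶ cod
  carrier : Set (F.X hom)
  isOpen : IsOpen carrier
  injOn : Set.InjOn (F.X hom).s carrier
  orbitInjOn : (F.X hom).right.OrbitInjOn carrier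

theorem exists_slice {x x' : C} (g : x ⟶ x') (γ : F.X g) {A : Set (F.X g)} (hA : IsOpen A)
    (hγ : γ ∈ A) : ∃ S : Set (F.X g), S ⊆ A ∧ γ ∈ S ∧ IsOpen S ∧ Set.InjOn (F.X g).s S ∧
      (F.X g).right.OrbitInjOn S := by
  obtain ⟨S, hS, hγS, hS'⟩ := (F.X g).isBasic.exists_orbitInjOn γ
  obtain ⟨e, he, hs⟩ := (F.X g).isLocalHomeomorph_right_anchor γ
  refine ⟨A ∩ (S ∩ e.source), Set.inter_subset_left, ⟨hγ, hγS, he⟩,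
    hA.inter (hS.inter e.open_source), ?_, ?_⟩
  · intro p hp q hq h
    refine e.injOn hp.2.2 hq.2.2 ?_
    rw [← hs]; exact h
  · exact fun y hy g e h => hS' y hy.2.1 g e h.2.1

/-- A slice through a given point. -/
noncomputable def sliceAt {x x' : C} (g : x ⟶ x') (γ : F.X g) : F.Slice where
  hom := g
  carrier := (exists_slice g γ isOpen_univ trivial).choose
  isOpen := (exists_slice g γ isOpen_univ trivial).choose_spec.2.2.1
  injOn := (exists_slice g γ isOpen_univ trivial).choose_spec.2.2.2.1
  orbitInjOn := (exists_slice g γ isOpen_univ trivial).choose_spec.2.2.2.2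

theorem mem_sliceAt {x x' : C} (g : x ⟶ x') (γ : F.X g) : γ ∈ (sliceAt g γ).carrier :=
  (exists_slice g γ isOpen_univ trivial).choose_spec.2.1

theorem continuous_s {x x' : C} (g : x ⟶ x') : Continuous (F.X g).s :=
  (F.X g).right.continuous_anchor

theorem continuous_r {x x' : C} (g : x ⟶ x') : Continuous (F.X g).r :=
  (F.X g).left.continuous_anchor

theorem isOpenMap_s {x x' : C} (g : x ⟶ x') : IsOpenMap (F.X g).s :=
  (F.X g).isLocalHomeomorph_right_anchor.isOpenMap

/-- Words in slices and their formal inverses. -/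
abbrev SliceWord (F : CorrespondenceDiagram C) : Type u :=
  List (Bool × F.Slice)

/-- The formal inverse of a word. -/
def SliceWord.inv (w : F.SliceWord) : F.SliceWord :=
  (w.map fun l => (!l.1, l.2)).reverse

namespace Action

variable {Y Y' : Type u} [TopologicalSpace Y] [TopologicalSpace Y'] (a : F.Action Y)
  (a' : F.Action Y')

theorem s_eq_s {y : Y} {x : C} {b b' : (F.Gr x).Obj} (e : a.anchor y = ⟨x, b⟩)
    (e' : a.anchor y = ⟨x, b'⟩) : b = b' :=
  sigma_mk_injective (β := fun x => (F.Gr x).Obj) (e.symm.trans e')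

theorem act_congr {x x' : C} {g : x ⟶ x'} {γ γ' : F.X g} {y y' : Y} (hγ : γ = γ') (hy : y = y')
    (e : a.anchor y = ⟨x, (F.X g).s γ⟩) (e' : a.anchor y' = ⟨x, (F.X g).s γ'⟩) :
    a.act g γ y e = a.act g γ' y' e' := by
  subst hγ hy; rfl

/-- No unit law is among the axioms of an `F`-action. It follows from surjectivity: write `y = γ ·
z` with `γ` in `X (𝟙 x)` and absorb the unit into `γ`. -/
theorem act_unit {x : C} (b : (F.Gr x).Obj) (y : Y)
    (e : a.anchor y = ⟨x, (F.X (𝟙 x)).s (F.one x ((F.Gr x).unit b))⟩) :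
    a.act (𝟙 x) (F.one x ((F.Gr x).unit b)) y e = y := by
  obtain ⟨γ, z, e', rfl⟩ := a.surjective_act (𝟙 x) y (by rw [e])
  have hb : (F.X (𝟙 x)).r γ = b := by
    have := a.s_eq_s (a.anchor_act (𝟙 x) γ z e') e
    rw [this, F.s_one, (F.Gr x).s_unit]
  subst hb
  have h1 := F.one_mul (𝟙 x) ((F.Gr x).unit ((F.X (𝟙 x)).r γ)) γ ((F.Gr x).s_unit _)
  have h2 : (F.X (𝟙 x)).left.act ((F.Gr x).unit ((F.X (𝟙 x)).r γ)) γ ((F.Gr x).s_unit _) = γ :=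
    (F.X (𝟙 x)).left.unit_act γ
  rw [a.mul_act (𝟙 x) (𝟙 x) (𝟙 x) (Category.comp_id _) _ γ z
    ((F.s_one x _).trans ((F.Gr x).s_unit _)) e']
  exact a.act_congr (h1.trans h2) rfl _ _

theorem act_act_one {x x' : C} (g : x ⟶ x') (γ : F.X g) (η : (F.Gr x).Arr) (y : Y)
    (e : (F.X g).s γ = (F.Gr x).r η) (e' : a.anchor y = ⟨x, (F.X (𝟙 x)).s (F.one x η)⟩)
    (e₁ : a.anchor (a.act (𝟙 x) (F.one x η) y e') = ⟨x, (F.X g).s γ⟩)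
    (e₂ : a.anchor y = ⟨x, (F.X g).s ((F.X g).right.act γ η e)⟩) :
    a.act g γ (a.act (𝟙 x) (F.one x η) y e') e₁ = a.act g ((F.X g).right.act γ η e) y e₂ := by
  rw [a.mul_act g (𝟙 x) g (Category.id_comp _) γ (F.one x η) y (e.trans (F.r_one x η).symm) e']
  exact a.act_congr (F.mul_one g γ η e) rfl _ _

theorem anchor_act_one {x x' : C} {g : x ⟶ x'} {γ : F.X g} {η : (F.Gr x).Arr} {y : Y}
    (e : (F.X g).s γ = (F.Gr x).r η) (e' : a.anchor y = ⟨x, (F.X (𝟙 x)).s (F.one x η)⟩) :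
    a.anchor (a.act (𝟙 x) (F.one x η) y e') = ⟨x, (F.X g).s γ⟩ := by
  rw [a.anchor_act, F.r_one, e]

/-- The partial homeomorphism of a slice, as a relation. -/
def Step (S : F.Slice) (y z : Y) : Prop :=
  ∃ γ ∈ S.carrier, ∃ e : a.anchor y = ⟨S.dom, (F.X S.hom).s γ⟩, a.act S.hom γ y e = z

variable {a a'}

theorem Step.right_unique {S : F.Slice} {y z z' : Y} (h : a.Step S y z) (h' : a.Step S y z') :
    z = z' := by
  obtain ⟨γ, hγ, e, rfl⟩ := h
  obtain ⟨γ', hγ', e', rfl⟩ := h'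
  exact a.act_congr (S.injOn hγ hγ' (a.s_eq_s e e')) rfl _ _

/-- Points of the form `γ · y = γ' · y'` with `γ` and `γ'` in the same slice. -/
theorem eq_and_eq_of_act_eq {x x' : C} {g : x ⟶ x'} {S : Set (F.X g)}
    (hS : (F.X g).right.OrbitInjOn S) {γ γ' : F.X g} (hγ : γ ∈ S) (hγ' : γ' ∈ S) {y y' : Y}
    {e : a.anchor y = ⟨x, (F.X g).s γ⟩} {e' : a.anchor y' = ⟨x, (F.X g).s γ'⟩}
    (h : a.act g γ y e = a.act g γ' y' e') : γ = γ' ∧ y = y' := by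
  obtain ⟨η, h1, h2, rfl, rfl⟩ := a.exists_of_act_eq g γ γ' y y' e e' h
  -- The arrow `η` fixes `γ`, so by freeness it is a unit, and units act trivially.
  have h3 := hS γ hγ η h1 hγ'
  have h4 := (F.X g).isBasic.eq_unit h1 h3
  refine ⟨h3.symm, ?_⟩
  subst h4
  exact a.act_unit _ _ _

theorem Step.left_unique {S : F.Slice} {y y' z : Y} (h : a.Step S y z) (h' : a.Step S y' z) :
    y = y' := by
  obtain ⟨γ, hγ, e, rfl⟩ := h
  obtain ⟨γ', hγ', e', h⟩ := h'
  exact (eq_and_eq_of_act_eq S.orbitInjOn hγ hγ' h.symm).2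

theorem step_sliceAt {x x' : C} (g : x ⟶ x') (γ : F.X g) (y : Y)
    (e : a.anchor y = ⟨x, (F.X g).s γ⟩) : a.Step (sliceAt g γ) y (a.act g γ y e) :=
  ⟨γ, mem_sliceAt g γ, e, rfl⟩

theorem isOpenMap_snd {x x' : C} (a : F.Action Y) (g : x ⟶ x') :
    IsOpenMap fun p : {p : F.X g × Y // a.anchor p.2 = ⟨x, (F.X g).s p.1⟩} => p.1.2 :=
  isOpenMap_snd_pullback (g := fun γ : F.X g => (⟨x, (F.X g).s γ⟩ : F.ObjSpace))
    a.continuous_anchor (isOpenMap_sigmaMk.comp (isOpenMap_s g))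

/-- Continuity of the multiplication makes the relevant pairs open; the projection to `Y` is open
because `s` is. -/
theorem isOpen_step_left (a : F.Action Y) (S : F.Slice) {O : Set Y} (hO : IsOpen O) :
    IsOpen {y | ∃ z ∈ O, a.Step S y z} := by
  have h := a.isOpenMap_snd S.hom _ ((hO.preimage (a.continuous_act S.hom)).inter
    (S.isOpen.preimage (continuous_fst.comp continuous_subtype_val)))
  convert h using 1
  ext y
  constructor
  · rintro ⟨_, hz, γ, hγ, e, rfl⟩
    exact ⟨⟨(γ, y), e⟩, ⟨hz, hγ⟩, rfl⟩
  · rintro ⟨⟨⟨γ, y⟩, e⟩, ⟨hz, hγ⟩, rfl⟩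
    exact ⟨_, hz, γ, hγ, e, rfl⟩

/-- This is where openness of the multiplication is needed: formal inverses of slices then act
continuously. -/
theorem isOpen_step_right (a : F.Action Y) (S : F.Slice) {O : Set Y} (hO : IsOpen O) :
    IsOpen {z | ∃ y ∈ O, a.Step S y z} := by
  have h := a.isOpenMap_act S.hom _
    ((S.isOpen.prod hO).preimage continuous_subtype_val)
  convert h using 1
  ext z
  constructor
  · rintro ⟨y, hy, γ, hγ, e, rfl⟩
    exact ⟨⟨(γ, y), e⟩, ⟨hγ, hy⟩, rfl⟩
  · rintro ⟨⟨⟨γ, y⟩, e⟩, ⟨hγ, hy⟩, rfl⟩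
    exact ⟨y, hy, γ, hγ, e, rfl⟩

variable (a) in
/-- The action of a slice or of its formal inverse, as a relation. -/
def LetterRel : Bool × F.Slice → Y → Y → Prop
  | (true, S), y, z => a.Step S y z
  | (false, S), y, z => a.Step S z y

variable (a) in
/-- The action of a word in slices, as a relation. The first letter acts first. -/
def WordRel : F.SliceWord → Y → Y → Prop
  | [], y, z => y = z
  | l :: w, y, z => ∃ t, a.LetterRel l y t ∧ WordRel w t z

theorem letterRel_not {l : Bool × F.Slice} {y z : Y} :
    a.LetterRel (!l.1, l.2) y z ↔ a.LetterRel l z y := by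
  obtain ⟨_ | _, S⟩ := l <;> rfl

theorem LetterRel.right_unique {l : Bool × F.Slice} {y z z' : Y} (h : a.LetterRel l y z)
    (h' : a.LetterRel l y z') : z = z' := by
  obtain ⟨_ | _, S⟩ := l
  · exact Step.left_unique h h'
  · exact Step.right_unique h h'

theorem WordRel.right_unique {w : F.SliceWord} {y z z' : Y} (h : a.WordRel w y z)
    (h' : a.WordRel w y z') : z = z' := by
  induction w generalizing y with
  | nil => exact h.symm.trans h'
  | cons l w ih =>
    obtain ⟨t, h1, h2⟩ := h
    obtain ⟨t', h1', h2'⟩ := h'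
    obtain rfl := h1.right_unique h1'
    exact ih h2 h2'

theorem wordRel_append {w w' : F.SliceWord} {y z : Y} :
    a.WordRel (w ++ w') y z ↔ ∃ t, a.WordRel w y t ∧ a.WordRel w' t z := by
  induction w generalizing y with
  | nil => simp [WordRel]
  | cons l w ih =>
    simp only [List.cons_append, WordRel, ih]
    constructor
    · rintro ⟨t, h1, s, h2, h3⟩
      exact ⟨s, ⟨t, h1, h2⟩, h3⟩
    · rintro ⟨s, ⟨t, h1, h2⟩, h3⟩
      exact ⟨t, h1, s, h2, h3⟩

theorem wordRel_singleton {l : Bool × F.Slice} {y z : Y} :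
    a.WordRel [l] y z ↔ a.LetterRel l y z := by
  simp [WordRel]

theorem wordRel_inv {w : F.SliceWord} {y z : Y} :
    a.WordRel w.inv y z ↔ a.WordRel w z y := by
  induction w generalizing y z with
  | nil => exact eq_comm
  | cons l w ih =>
    have : SliceWord.inv (l :: w) = SliceWord.inv w ++ [(!l.1, l.2)] := by
      simp [SliceWord.inv]
    rw [this, wordRel_append]
    simp only [ih, wordRel_singleton, letterRel_not]
    exact exists_congr fun _ => and_comm

theorem isOpen_letterRel (a : F.Action Y) (l : Bool × F.Slice) {O : Set Y} (hO : IsOpen O) :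
    IsOpen {y | ∃ z ∈ O, a.LetterRel l y z} := by
  obtain ⟨_ | _, S⟩ := l
  · exact a.isOpen_step_right S hO
  · exact a.isOpen_step_left S hO

theorem isOpen_wordRel (a : F.Action Y) (w : F.SliceWord) {O : Set Y} (hO : IsOpen O) :
    IsOpen {y | ∃ z ∈ O, a.WordRel w y z} := by
  induction w with
  | nil => simpa [WordRel] using hO
  | cons l w ih =>
    convert a.isOpen_letterRel l ih using 1
    ext y
    constructor
    · rintro ⟨z, hz, t, h1, h2⟩
      exact ⟨t, ⟨z, hz, h2⟩, h1⟩
    · rintro ⟨t, ⟨z, hz, h2⟩, h1⟩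
      exact ⟨z, hz, t, h1, h2⟩

/-! ### Bisimulations and codes -/

variable (a a') in
/-- A relation between two `F`-actions that is compatible with anchors, with multiplications, and
with decompositions `y = γ · z`. -/
structure IsBisimulation (R : Y → Y' → Prop) : Prop where
  anchor_eq : ∀ {y y'}, R y y' → a.anchor y = a'.anchor y'
  act : ∀ {y y'}, R y y' → ∀ {x x' : C} (g : x ⟶ x') (γ : F.X g)
    (e : a.anchor y = ⟨x, (F.X g).s γ⟩) (e' : a'.anchor y' = ⟨x, (F.X g).s γ⟩),
    R (a.act g γ y e) (a'.act g γ y' e')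
  exists_act : ∀ {y y'}, R y y' → ∀ {x x' : C} (g : x ⟶ x'), (a.anchor y).1 = x' →
    ∃ (γ : F.X g) (z : Y) (z' : Y') (e : a.anchor z = ⟨x, (F.X g).s γ⟩)
      (e' : a'.anchor z' = ⟨x, (F.X g).s γ⟩), a.act g γ z e = y ∧ a'.act g γ z' e' = y' ∧ R z z'

namespace IsBisimulation

variable {R : Y → Y' → Prop}

theorem flip (h : IsBisimulation a a' R) : IsBisimulation a' a fun y' y => R y y' where
  anchor_eq hy := (h.anchor_eq hy).symm
  act hy x x' g γ e e' := h.act hy g γ e' e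
  exists_act := by
    intro y' y hy x x' g hx
    obtain ⟨γ, z, z', e, e', h1, h2, h3⟩ := h.exists_act hy g
      ((congrArg _ (h.anchor_eq hy)).trans hx)
    exact ⟨γ, z', z, e', e, h2, h1, h3⟩

/-- A slice is transported by the clause `act`, an inverse slice by the clause `exists_act`, up to a
correction by an arrow of the groupoid. -/
theorem exists_letterRel (h : IsBisimulation a a' R) {y : Y} {y' : Y'} (hy : R y y')
    {l : Bool × F.Slice} {z : Y} (hl : a.LetterRel l y z) :
    ∃ z', a'.LetterRel l y' z' ∧ R z z' := by
  obtain ⟨_ | _, S⟩ := l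
  · obtain ⟨γ, hγ, e, rfl⟩ := hl
    obtain ⟨γ', y₁, y₁', e₁, e₁', h1, rfl, h3⟩ := h.exists_act hy S.hom (by rw [a.anchor_act])
    -- The common factor `γ'` supplied by the bisimulation need not lie in the slice. It equals `γ ·
    -- η`, and moving `η` to the other factor restores the given `γ`.
    obtain ⟨η, h4, h5, rfl, rfl⟩ := a.exists_of_act_eq S.hom γ γ' _ _ e e₁ h1.symm
    have h5' := (h.anchor_eq h3).symm.trans h5
    refine ⟨a'.act (𝟙 _) (F.one _ η) y₁' h5', ⟨γ, hγ, a'.anchor_act_one h4 h5', ?_⟩,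
      h.act h3 _ _ _ _⟩
    exact a'.act_act_one S.hom γ η y₁' h4 h5' _ _
  · obtain ⟨γ, hγ, e, rfl⟩ := hl
    exact ⟨_, ⟨γ, hγ, (h.anchor_eq hy).symm.trans e, rfl⟩, h.act hy _ _ _ _⟩

theorem exists_wordRel (h : IsBisimulation a a' R) {y : Y} {y' : Y'} (hy : R y y')
    {w : F.SliceWord} {z : Y} (hw : a.WordRel w y z) : ∃ z', a'.WordRel w y' z' ∧ R z z' := by
  induction w generalizing y y' with
  | nil =>
    obtain rfl : y = z := hw
    exact ⟨y', rfl, hy⟩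
  | cons l w ih =>
    obtain ⟨t, h1, h2⟩ := hw
    obtain ⟨t', h1', h3⟩ := h.exists_letterRel hy h1
    obtain ⟨z', h4, h5⟩ := ih h3 h2
    exact ⟨z', ⟨t', h1', h4⟩, h5⟩

end IsBisimulation

variable (a) in
/-- The code of a point: the anchors of its images under all words in slices. -/
def code (y : Y) : F.SliceWord → Set F.ObjSpace :=
  fun w => {b | ∃ z, a.WordRel w y z ∧ a.anchor z = b}

theorem IsBisimulation.code_eq {R : Y → Y' → Prop} (h : IsBisimulation a a' R) {y : Y} {y' : Y'}
    (hy : R y y') : a.code y = a'.code y' := by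
  funext w
  ext b
  constructor
  · rintro ⟨z, hz, rfl⟩
    obtain ⟨z', h1, h2⟩ := h.exists_wordRel hy hz
    exact ⟨z', h1, (h.anchor_eq h2).symm⟩
  · rintro ⟨z, hz, rfl⟩
    obtain ⟨z', h1, h2⟩ := h.flip.exists_wordRel hy hz
    exact ⟨z', h1, h.anchor_eq h2⟩

theorem IsEquivariant.isBisimulation {φ : Y → Y'} (h : a.IsEquivariant a' φ) :
    IsBisimulation a a' fun y y' => φ y = y' where
  anchor_eq := by
    rintro y _ rfl
    exact (h.2.1 y).symm
  act := by
    rintro y _ rfl x x' g γ e e'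
    exact h.2.2 g γ y e
  exists_act := by
    rintro y _ rfl x x' g hx
    obtain ⟨γ, z, e, rfl⟩ := a.surjective_act g y hx
    exact ⟨γ, z, φ z, e, (h.2.1 z).trans e, rfl, (h.2.2 g γ z e).symm, rfl⟩

end Action

end CorrespondenceDiagram

/-! ### The space of codes -/

namespace CorrespondenceDiagram

variable {C : Type u} [SmallCategory C] {F : CorrespondenceDiagram C}

namespace Action

variable {Y Y' : Type u} [TopologicalSpace Y] [TopologicalSpace Y'] {a : F.Action Y}
  {a' : F.Action Y'}

theorem code_nil (y : Y) : a.code y [] = {a.anchor y} := by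
  ext b
  simp [code, WordRel, eq_comm]

/-- Letters act by partial functions, so the code of a point determines the codes of all its images
by shifting. -/
theorem code_cons {l : Bool × F.Slice} {y z : Y} (h : a.LetterRel l y z) (w : F.SliceWord) :
    a.code y (l :: w) = a.code z w := by
  ext b
  constructor
  · rintro ⟨t, ⟨z', h1, h2⟩, rfl⟩
    obtain rfl := h1.right_unique h
    exact ⟨t, h2, rfl⟩
  · rintro ⟨t, h1, rfl⟩
    exact ⟨t, ⟨z, h, h1⟩, rfl⟩

theorem anchor_eq_of_code_eq {y : Y} {y' : Y'} (h : a.code y = a'.code y') :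
    a.anchor y = a'.anchor y' := by
  have := congrFun h []
  rwa [code_nil, code_nil, Set.singleton_eq_singleton_iff] at this

/-- A letter is defined at a point exactly when the code is nonempty at the one-letter word. -/
theorem exists_letterRel_of_code_eq {y : Y} {y' : Y'} (h : a.code y = a'.code y')
    {l : Bool × F.Slice} {z : Y} (hl : a.LetterRel l y z) :
    ∃ z', a'.LetterRel l y' z' ∧ a.code z = a'.code z' := by
  have h1 : a.anchor z ∈ a'.code y' [l] := h ▸ ⟨z, wordRel_singleton.mpr hl, rfl⟩
  obtain ⟨z', h2, -⟩ := h1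
  rw [wordRel_singleton] at h2
  exact ⟨z', h2, funext fun w => by rw [← code_cons hl, ← code_cons h2, h]⟩

/-- Together with `IsBisimulation.code_eq`, this makes equality of codes the largest bisimulation.
Each `γ` is tested by the letter of a slice through it. -/
theorem isBisimulation_code_eq (a : F.Action Y) (a' : F.Action Y') :
    IsBisimulation a a' fun y y' => a.code y = a'.code y' where
  anchor_eq := anchor_eq_of_code_eq
  act := by
    intro y y' h x x' g γ e e'
    obtain ⟨z', h1, h2⟩ := exists_letterRel_of_code_eq h (l := (true, sliceAt g γ))
      (step_sliceAt g γ y e)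
    obtain rfl := Step.right_unique h1 (step_sliceAt g γ y' e')
    exact h2
  exists_act := by
    intro y y' h x x' g hx
    obtain ⟨γ, z, e, rfl⟩ := a.surjective_act g y hx
    obtain ⟨z', h1, h2⟩ := exists_letterRel_of_code_eq h
      (l := (false, sliceAt g γ)) (step_sliceAt g γ z e)
    have h3 := (anchor_eq_of_code_eq h2).symm.trans e
    exact ⟨γ, z, z', e, h3, rfl, Step.right_unique (step_sliceAt g γ z' h3) h1, h2⟩

end Action

variable (F) in
/-- The space of codes of points of `F`-actions. -/
def CodeSpace : Type u :=
  {κ : F.SliceWord → Set F.ObjSpace //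
    ∃ (Y : Type u) (_ : TopologicalSpace Y) (a : F.Action Y) (y : Y), a.code y = κ}

/-- The code of a point of an `F`-action, as a point of the space of codes. -/
def Action.toCode {Y : Type u} [TopologicalSpace Y] (a : F.Action Y) (y : Y) : F.CodeSpace :=
  ⟨a.code y, Y, _, a, y, rfl⟩

theorem Action.toCode_eq_iff {Y Y' : Type u} [TopologicalSpace Y] [TopologicalSpace Y']
    {a : F.Action Y} {a' : F.Action Y'} {y : Y} {y' : Y'} :
    a.toCode y = a'.toCode y' ↔ a.code y = a'.code y' :=
  Subtype.ext_iff

namespace CodeSpace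

/-- The basic open subset of codes that have an anchor in `V` at the word `w`. -/
def basicOpen (w : F.SliceWord) (V : Set F.ObjSpace) : Set F.CodeSpace :=
  {κ | (κ.1 w ∩ V).Nonempty}

/-- The generating sets pull back to open sets in every `F`-action by `isOpen_wordRel`, and
prepending letters permits continuity and openness of the multiplication to be checked on them. -/
instance : TopologicalSpace F.CodeSpace :=
  TopologicalSpace.generateFrom {O | ∃ w V, IsOpen V ∧ basicOpen w V = O}

theorem isOpen_basicOpen (w : F.SliceWord) {V : Set F.ObjSpace} (hV : IsOpen V) :
    IsOpen (basicOpen w V) :=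
  TopologicalSpace.isOpen_generateFrom_of_mem ⟨w, V, hV, rfl⟩

theorem toCode_mem_basicOpen {Y : Type u} [TopologicalSpace Y] {a : F.Action Y} {y : Y}
    {w : F.SliceWord} {V : Set F.ObjSpace} :
    a.toCode y ∈ basicOpen w V ↔ ∃ z ∈ a.anchor ⁻¹' V, a.WordRel w y z := by
  constructor
  · rintro ⟨_, ⟨z, h, rfl⟩, hV⟩
    exact ⟨z, hV, h⟩
  · rintro ⟨z, hV, h⟩
    exact ⟨_, ⟨z, h, rfl⟩, hV⟩

theorem exists_toCode_eq (κ : F.CodeSpace) :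
    ∃ (Y : Type u) (_ : TopologicalSpace Y) (a : F.Action Y) (y : Y), a.toCode y = κ := by
  obtain ⟨_, Y, _, a, y, rfl⟩ := κ
  exact ⟨Y, _, a, y, rfl⟩

/-- A code may come from many actions. Choosing a value common to all representatives gives a
definition that can be computed on any of them; `exists_act` has the same purpose. -/
theorem exists_anchor (κ : F.CodeSpace) : ∃ b : F.ObjSpace,
    ∀ (Y : Type u) [TopologicalSpace Y] (a : F.Action Y) (y : Y),
      a.toCode y = κ → a.anchor y = b := by
  obtain ⟨Y, _, a, y, rfl⟩ := κ.exists_toCode_eq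
  exact ⟨a.anchor y, fun Y' _ a' y' h =>
    Action.anchor_eq_of_code_eq (Action.toCode_eq_iff.mp h)⟩

/-- The anchor map on the space of codes. -/
noncomputable def anchor (κ : F.CodeSpace) : F.ObjSpace :=
  κ.exists_anchor.choose

@[simp]
theorem anchor_toCode {Y : Type u} [TopologicalSpace Y] (a : F.Action Y) (y : Y) :
    anchor (a.toCode y) = a.anchor y :=
  ((a.toCode y).exists_anchor.choose_spec Y a y rfl).symm

theorem exists_act {x x' : C} (g : x ⟶ x') (γ : F.X g) (κ : F.CodeSpace)
    (e : κ.anchor = ⟨x, (F.X g).s γ⟩) : ∃ κ' : F.CodeSpace,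
    ∀ (Y : Type u) [TopologicalSpace Y] (a : F.Action Y) (y : Y)
      (e' : a.anchor y = ⟨x, (F.X g).s γ⟩), a.toCode y = κ → a.toCode (a.act g γ y e') = κ' := by
  obtain ⟨Y, _, a, y, rfl⟩ := κ.exists_toCode_eq
  rw [anchor_toCode] at e
  exact ⟨a.toCode (a.act g γ y e), fun Y' _ a' y' e' h => Action.toCode_eq_iff.mpr
    ((Action.isBisimulation_code_eq a' a).act (Action.toCode_eq_iff.mp h) g γ e' e)⟩

/-- The multiplication on the space of codes. -/
noncomputable def act {x x' : C} (g : x ⟶ x') (γ : F.X g) (κ : F.CodeSpace)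
    (e : κ.anchor = ⟨x, (F.X g).s γ⟩) : F.CodeSpace :=
  (exists_act g γ κ e).choose

theorem act_toCode {x x' : C} (g : x ⟶ x') (γ : F.X g) {Y : Type u} [TopologicalSpace Y]
    (a : F.Action Y) (y : Y) (e : (a.toCode y).anchor = ⟨x, (F.X g).s γ⟩)
    (e' : a.anchor y = ⟨x, (F.X g).s γ⟩) :
    act g γ (a.toCode y) e = a.toCode (a.act g γ y e') :=
  ((exists_act g γ _ e).choose_spec Y a y e' rfl).symm

end CodeSpace

section Slices

variable {Y : Type u} [TopologicalSpace Y] {anchor : Y → F.ObjSpace} {x x' : C} {g : x ⟶ x'}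
  {act : ∀ (γ : F.X g) (y : Y), anchor y = ⟨x, (F.X g).s γ⟩ → Y}

/-- A multiplication is continuous if it is so on slices. -/
theorem continuous_of_slices
    (h : ∀ S : Set (F.X g), IsOpen S → Set.InjOn (F.X g).s S → (F.X g).right.OrbitInjOn S →
      ∀ O : Set Y, IsOpen O → IsOpen {y | ∃ γ ∈ S, ∃ e, act γ y e ∈ O}) :
    Continuous fun p : {p : F.X g × Y // anchor p.2 = ⟨x, (F.X g).s p.1⟩} =>
      act p.1.1 p.1.2 p.2 := by
  refine continuous_def.mpr fun O hO => isOpen_iff_mem_nhds.mpr ?_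
  rintro ⟨⟨γ, y⟩, e⟩ hγ
  obtain ⟨S, -, hγS, hS, h1, h2⟩ := exists_slice g γ isOpen_univ trivial
  have h3 := (hS.prod (h S hS h1 h2 O hO)).preimage
    (continuous_subtype_val (p := fun p : F.X g × Y => anchor p.2 = ⟨x, (F.X g).s p.1⟩))
  filter_upwards [h3.mem_nhds (show (⟨(γ, y), e⟩ : {p : F.X g × Y //
    anchor p.2 = ⟨x, (F.X g).s p.1⟩}) ∈ _ from ⟨hγS, γ, hγS, e, hγ⟩)]
  rintro ⟨⟨γ', y'⟩, e'⟩ ⟨h4, γ'', h5, e'', h6⟩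
  obtain rfl : γ'' = γ' := h1 h5 h4
    (sigma_mk_injective (β := fun x => (F.Gr x).Obj) (e''.symm.trans e'))
  exact h6

/-- A multiplication is open if it is so on slices. -/
theorem isOpenMap_of_slices
    (h : ∀ S : Set (F.X g), IsOpen S → Set.InjOn (F.X g).s S → (F.X g).right.OrbitInjOn S →
      ∀ O : Set Y, IsOpen O → IsOpen {z | ∃ y ∈ O, ∃ γ ∈ S, ∃ e, act γ y e = z}) :
    IsOpenMap fun p : {p : F.X g × Y // anchor p.2 = ⟨x, (F.X g).s p.1⟩} =>
      act p.1.1 p.1.2 p.2 := by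
  intro W hW
  obtain ⟨W', hW', rfl⟩ := isOpen_induced_iff.mp hW
  refine isOpen_iff_mem_nhds.mpr ?_
  rintro _ ⟨⟨⟨γ, y⟩, e⟩, hγ, rfl⟩
  obtain ⟨A, B, hA, hB, hγA, hyB, hAB⟩ := isOpen_prod_iff.mp hW' γ y hγ
  obtain ⟨S, hSA, hγS, hS, h1, h2⟩ := exists_slice g γ hA hγA
  filter_upwards [(h S hS h1 h2 B hB).mem_nhds ⟨y, hyB, γ, hγS, e, rfl⟩]
  rintro _ ⟨y', hy', γ', hγ', e', rfl⟩
  exact ⟨⟨(γ', y'), e'⟩, hAB ⟨hSA hγ', hy'⟩, rfl⟩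

end Slices

/-! ### The universal action -/

namespace CodeSpace

theorem continuous_anchor : Continuous (anchor : F.CodeSpace → F.ObjSpace) := by
  refine continuous_def.mpr fun V hV => ?_
  convert isOpen_basicOpen (F := F) [] hV using 1
  ext κ
  obtain ⟨Y, _, a, y, rfl⟩ := κ.exists_toCode_eq
  rw [toCode_mem_basicOpen]
  simp [Action.WordRel]

/-- The two codes may be represented in different actions. Applying an inverse letter carries the
factorisation of the first product over to the second action, where cancellation is available. -/
theorem exists_of_act_eq {x x' : C} (g : x ⟶ x') (γ γ' : F.X g) (κ κ' : F.CodeSpace)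
    (e : κ.anchor = ⟨x, (F.X g).s γ⟩) (e' : κ'.anchor = ⟨x, (F.X g).s γ'⟩)
    (h : act g γ κ e = act g γ' κ' e') :
    ∃ (η : (F.Gr x).Arr) (h : (F.X g).s γ = (F.Gr x).r η)
      (h' : κ'.anchor = ⟨x, (F.X (𝟙 x)).s (F.one x η)⟩),
      γ' = (F.X g).right.act γ η h ∧ κ = act (𝟙 x) (F.one x η) κ' h' := by
  obtain ⟨Y, _, a, y, rfl⟩ := κ.exists_toCode_eq
  obtain ⟨Y', _, a', y', rfl⟩ := κ'.exists_toCode_eq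
  have e₁ := (anchor_toCode a y).symm.trans e
  have e₁' := (anchor_toCode a' y').symm.trans e'
  rw [act_toCode g γ a y e e₁, act_toCode g γ' a' y' e' e₁', Action.toCode_eq_iff] at h
  obtain ⟨z, h1, h2⟩ := Action.exists_letterRel_of_code_eq h
    (l := (false, sliceAt g γ)) (Action.step_sliceAt g γ y e₁)
  have e₃ := (Action.anchor_eq_of_code_eq h2).symm.trans e₁
  have h1 := Action.Step.right_unique (Action.step_sliceAt g γ z e₃) h1
  obtain ⟨η, h3, h4, rfl, rfl⟩ := a'.exists_of_act_eq g γ γ' z y' e₃ e₁' h1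
  refine ⟨η, h3, (anchor_toCode a' y').trans h4, rfl, ?_⟩
  rw [act_toCode _ _ a' y' _ h4, Action.toCode_eq_iff]
  exact h2

/-- The image of a generating set under a slice is again a generating set, with the inverse letter
prepended to its word. Images commute with unions, and with intersections because slices act
injectively. -/
theorem isOpen_image_act {x x' : C} {g : x ⟶ x'} {S : Set (F.X g)} (hS : IsOpen S)
    (h1 : Set.InjOn (F.X g).s S) (h2 : (F.X g).right.OrbitInjOn S) {O : Set F.CodeSpace}
    (hO : IsOpen O) : IsOpen {κ' | ∃ κ ∈ O, ∃ γ ∈ S, ∃ e, act g γ κ e = κ'} := by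
  have key : ∀ (w : F.SliceWord) (V : Set F.ObjSpace),
      {κ' | ∃ κ ∈ basicOpen w V, ∃ γ ∈ S, ∃ e, act g γ κ e = κ'} =
        basicOpen ((false, ⟨g, S, hS, h1, h2⟩) :: w) V := by
    intro w V
    ext κ'
    constructor
    · rintro ⟨κ, hκ, γ, hγ, e, rfl⟩
      obtain ⟨Y, _, a, y, rfl⟩ := κ.exists_toCode_eq
      have e₁ := (anchor_toCode a y).symm.trans e
      rw [act_toCode g γ a y e e₁, toCode_mem_basicOpen]
      obtain ⟨z, hz, hw⟩ := toCode_mem_basicOpen.mp hκ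
      exact ⟨z, hz, y, ⟨γ, hγ, e₁, rfl⟩, hw⟩
    · intro hκ
      obtain ⟨Y, _, a, y, rfl⟩ := κ'.exists_toCode_eq
      obtain ⟨z, hz, t, ⟨γ, hγ, e, rfl⟩, hw⟩ := toCode_mem_basicOpen.mp hκ
      exact ⟨a.toCode t, toCode_mem_basicOpen.mpr ⟨z, hz, hw⟩, γ, hγ,
        (anchor_toCode a t).trans e, act_toCode _ _ _ _ _ _⟩
  induction hO with
  | basic O hO =>
    obtain ⟨w, V, hV, rfl⟩ := hO
    rw [key]
    exact isOpen_basicOpen _ hV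
  | univ =>
    have := key [] Set.univ
    have h3 : basicOpen (F := F) [] Set.univ = Set.univ := by
      refine Set.eq_univ_of_forall fun κ => ?_
      obtain ⟨Y, _, a, y, rfl⟩ := κ.exists_toCode_eq
      exact toCode_mem_basicOpen.mpr ⟨y, trivial, rfl⟩
    rw [h3] at this
    rw [this]
    exact isOpen_basicOpen _ isOpen_univ
  | inter O O' _ _ ih ih' =>
    convert ih.inter ih' using 1
    ext κ'
    constructor
    · rintro ⟨κ, ⟨h3, h4⟩, h5⟩
      exact ⟨⟨κ, h3, h5⟩, ⟨κ, h4, h5⟩⟩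
    · rintro ⟨⟨κ, h3, γ, hγ, e, rfl⟩, ⟨κ', h4, γ', hγ', e', h⟩⟩
      obtain ⟨η, h5, h6, rfl, rfl⟩ := exists_of_act_eq g γ' γ κ' κ e' e h
      -- Both factors lie in the slice, so `η` is a unit and the two preimages coincide.
      have h7 := h2 γ' hγ' η h5 hγ
      have h8 := (F.X g).isBasic.eq_unit h5 h7
      subst h8
      refine ⟨κ, ⟨h3, ?_⟩, _, hγ, e, rfl⟩
      obtain ⟨Y, _, a, y, rfl⟩ := κ.exists_toCode_eq
      have e₁ := (anchor_toCode a y).symm.trans h6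
      rw [act_toCode _ _ _ _ _ e₁, a.act_unit] at h4
      exact h4
  | sUnion s _ ih =>
    have : {κ' | ∃ κ ∈ ⋃₀ s, ∃ γ ∈ S, ∃ e, act g γ κ e = κ'} =
        ⋃ O ∈ s, {κ' | ∃ κ ∈ O, ∃ γ ∈ S, ∃ e, act g γ κ e = κ'} := by
      ext κ'
      simp only [Set.mem_sUnion, Set.mem_ofPred_eq, Set.mem_iUnion, exists_prop]
      constructor
      · rintro ⟨κ, ⟨O, hO, hκ⟩, h⟩
        exact ⟨O, hO, κ, hκ, h⟩
      · rintro ⟨O, hO, κ, hκ, h⟩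
        exact ⟨κ, ⟨O, hO, hκ⟩, h⟩
    rw [this]
    exact isOpen_biUnion ih

/-- Near `γ` only a slice through `γ` matters, and there the preimage of a generating set is the
generating set with that letter prepended. -/
theorem continuous_act {x x' : C} (g : x ⟶ x') :
    Continuous fun p : {p : F.X g × F.CodeSpace // anchor p.2 = ⟨x, (F.X g).s p.1⟩} =>
      act g p.1.1 p.1.2 p.2 := by
  refine continuous_generateFrom_iff.mpr ?_
  rintro _ ⟨w, V, hV, rfl⟩
  refine isOpen_iff_mem_nhds.mpr ?_
  rintro ⟨⟨γ, κ⟩, e⟩ h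
  have h1 := ((sliceAt g γ).isOpen.prod (isOpen_basicOpen ((true, sliceAt g γ) :: w) hV)).preimage
    (continuous_subtype_val (p := fun p : F.X g × F.CodeSpace =>
      anchor p.2 = ⟨x, (F.X g).s p.1⟩))
  have h0 : (⟨(γ, κ), e⟩ : {p : F.X g × F.CodeSpace // anchor p.2 = ⟨x, (F.X g).s p.1⟩}) ∈
      Subtype.val ⁻¹' ((sliceAt g γ).carrier ×ˢ basicOpen ((true, sliceAt g γ) :: w) V) := by
    refine ⟨mem_sliceAt g γ, ?_⟩
    obtain ⟨Y, _, a, y, rfl⟩ := κ.exists_toCode_eq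
    have e₁ := (anchor_toCode a y).symm.trans e
    simp only [Set.mem_preimage] at h
    rw [act_toCode g _ a y e e₁] at h
    obtain ⟨z, hz, hw⟩ := toCode_mem_basicOpen.mp h
    exact toCode_mem_basicOpen.mpr ⟨z, hz, _, Action.step_sliceAt g γ y e₁, hw⟩
  filter_upwards [h1.mem_nhds h0]
  rintro ⟨⟨γ', κ'⟩, e'⟩ ⟨h2, h3⟩
  obtain ⟨Y, _, a, y, rfl⟩ := κ'.exists_toCode_eq
  have e₁ := (anchor_toCode a y).symm.trans e'
  obtain ⟨z, hz, t, ⟨γ'', h4, e₂, rfl⟩, hw⟩ := toCode_mem_basicOpen.mp h3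
  obtain rfl := (sliceAt g γ).injOn h4 h2 (a.s_eq_s e₂ e₁)
  simp only [Set.mem_preimage]
  rw [act_toCode g _ a y e' e₁]
  exact toCode_mem_basicOpen.mpr ⟨z, hz, hw⟩

variable (F) in
/-- The `F`-action on the space of codes. -/
noncomputable def action : F.Action F.CodeSpace where
  anchor := anchor
  continuous_anchor := continuous_anchor
  act := act
  anchor_act := by
    intro x x' g γ κ e
    obtain ⟨Y, _, a, y, rfl⟩ := κ.exists_toCode_eq
    rw [act_toCode g γ a y e ((anchor_toCode a y).symm.trans e), anchor_toCode, a.anchor_act]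
  continuous_act := continuous_act
  isOpenMap_act g := isOpenMap_of_slices fun _ hS h1 h2 _ hO => isOpen_image_act hS h1 h2 hO
  surjective_act := by
    intro x x' g κ hx
    obtain ⟨Y, _, a, y, rfl⟩ := κ.exists_toCode_eq
    rw [anchor_toCode] at hx
    obtain ⟨γ, z, e, rfl⟩ := a.surjective_act g y hx
    exact ⟨γ, a.toCode z, (anchor_toCode a z).trans e, act_toCode _ _ _ _ _ _⟩
  mul_act := by
    intro x y z g h k hk γ₁ γ₂ κ e e'
    obtain ⟨Y, _, a, w, rfl⟩ := κ.exists_toCode_eq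
    have e₁ := (anchor_toCode a w).symm.trans e'
    have e₂ : a.anchor (a.act h γ₂ w e₁) = ⟨y, (F.X g).s γ₁⟩ := by rw [a.anchor_act, e]
    have e₃ := e₁.trans (congrArg (Sigma.mk x) (F.s_mul g h k hk γ₁ γ₂ e).symm)
    rw [act_toCode k _ a w _ e₃]
    -- The inner product is generalised because the anchor proof in the outer one depends on it.
    have : ∀ κ' (e₄ : anchor κ' = ⟨y, (F.X g).s γ₁⟩), κ' = a.toCode (a.act h γ₂ w e₁) →
        act g γ₁ κ' e₄ = a.toCode (a.act k (F.mul g h k hk (.mk γ₁ γ₂ e)) w e₃) := by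
      rintro _ e₄ rfl
      rw [act_toCode g _ a _ e₄ e₂, a.mul_act g h k hk γ₁ γ₂ w e e₁]
    exact this _ _ (act_toCode h γ₂ a w e' e₁)
  exists_of_act_eq := exists_of_act_eq

end CodeSpace

namespace Action

variable {Y : Type u} [TopologicalSpace Y] (a : F.Action Y)

theorem isEquivariant_toCode : a.IsEquivariant (CodeSpace.action F) a.toCode := by
  refine ⟨?_, fun y => CodeSpace.anchor_toCode a y, fun g γ y e =>
    (CodeSpace.act_toCode g γ a y ((CodeSpace.anchor_toCode a y).trans e) e).symm⟩
  refine continuous_generateFrom_iff.mpr ?_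
  rintro _ ⟨w, V, hV, rfl⟩
  convert a.isOpen_wordRel w (hV.preimage a.continuous_anchor) using 1
  ext y
  exact CodeSpace.toCode_mem_basicOpen

theorem IsEquivariant.toCode_eq {a : F.Action Y} {Y' : Type u} [TopologicalSpace Y']
    {a' : F.Action Y'} {φ : Y → Y'} (h : a.IsEquivariant a' φ) (y : Y) : a'.toCode (φ y) = a.toCode y :=
  toCode_eq_iff.mpr (h.isBisimulation.code_eq rfl).symm

/-- Write `κ` as the code of a point. Taking codes is equivariant, and equivariant maps preserve
codes. Uniqueness in the universal property rests on this. -/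
theorem toCode_action (κ : F.CodeSpace) : (CodeSpace.action F).toCode κ = κ := by
  obtain ⟨Y, _, a, y, rfl⟩ := κ.exists_toCode_eq
  exact a.isEquivariant_toCode.toCode_eq y

end Action

variable (F) in
theorem CodeSpace.isUniversal_action : (CodeSpace.action F).IsUniversal := by
  intro Y _ a
  refine ⟨a.toCode, a.isEquivariant_toCode, fun φ h => funext fun y => ?_⟩
  rw [← h.toCode_eq y, Action.toCode_action]

end CorrespondenceDiagram

/-! ### Lifting and amalgamating ultrafilters -/

namespace Ultrafilter

variable {A B Z : Type*}

/-- The hypothesis says exactly that the pullback of `𝒰` meets `l`; any ultrafilter below both will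
do. -/
theorem exists_le_map_eq {m : A → Z} {𝒰 : Ultrafilter Z} {l : Filter A}
    (h : ∀ N ∈ l, m '' N ∈ 𝒰) : ∃ 𝒲 : Ultrafilter A, ↑𝒲 ≤ l ∧ 𝒲.map m = 𝒰 := by
  have hne : (Filter.comap m 𝒰 ⊓ l).NeBot := by
    rw [Filter.inf_neBot_iff]
    rintro S ⟨T, hT, hS⟩ N hN
    obtain ⟨_, ⟨p, hp, rfl⟩, hpT⟩ := 𝒰.nonempty_of_mem (𝒰.inter_sets (h N hN) hT)
    exact ⟨p, hS hpT, hp⟩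
  have hle := of_le (Filter.comap m 𝒰 ⊓ l)
  exact ⟨_, hle.trans inf_le_right, eq_of_le
    ((Filter.map_mono (hle.trans inf_le_left)).trans Filter.map_comap_le)⟩

theorem eq_of_map_eq_of_injOn {m : A → Z} {𝒱 𝒲 : Ultrafilter A} (h : 𝒱.map m = 𝒲.map m)
    {E : Set A} (hE : Set.InjOn m E) (h1 : E ∈ 𝒱) (h2 : E ∈ 𝒲) : 𝒱 = 𝒲 := by
  refine (eq_of_le fun T hT => ?_).symm
  have h3 : m '' (T ∩ E) ∈ 𝒲.map m := h ▸ Filter.image_mem_map (Filter.inter_mem hT h1)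
  filter_upwards [h3, h2]
  rintro p ⟨q, ⟨hq, hqE⟩, hqp⟩ hpE
  exact hE hqE hpE hqp ▸ hq

/-- Lift `𝒱` along the first projection, subject to the filter pulled back from `𝒲`. -/
theorem exists_amalgam {f : A → Z} {g : B → Z} {𝒱 : Ultrafilter A} {𝒲 : Ultrafilter B}
    (h : 𝒱.map f = 𝒲.map g) : ∃ 𝒯 : Ultrafilter {p : A × B // f p.1 = g p.2},
      𝒯.map (fun p => p.1.1) = 𝒱 ∧ 𝒯.map (fun p => p.1.2) = 𝒲 := by
  obtain ⟨𝒯, h1, h2⟩ := exists_le_map_eq (m := fun p : {p : A × B // f p.1 = g p.2} => p.1.1)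
    (𝒰 := 𝒱) (l := Filter.comap (fun p => p.1.2) 𝒲) (by
      rintro N ⟨T, hT, hN⟩
      have h3 : g '' T ∈ 𝒱.map f := h ▸ Filter.image_mem_map hT
      filter_upwards [h3]
      rintro a ⟨b, hb, hab⟩
      exact ⟨⟨(a, b), hab.symm⟩, hN hb, rfl⟩)
  exact ⟨𝒯, h2, eq_of_le ((Filter.map_mono h1).trans Filter.map_comap_le)⟩

end Ultrafilter

/-! ### The action on ultrafilters with convergent anchor -/

namespace CorrespondenceDiagram

open Filter

variable {C : Type u} [SmallCategory C] {F : CorrespondenceDiagram C}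

theorem IsLocallyCompact.t2Space (hl : F.IsLocallyCompact) : T2Space F.ObjSpace :=
  have := fun x => (hl.1 x).1
  inferInstance

variable (F) in
theorem isOpenEmbedding_mk (x : C) :
    IsOpenEmbedding fun b : (F.Gr x).Obj => (⟨x, b⟩ : F.ObjSpace) :=
  IsOpenEmbedding.sigmaMk (σ := fun x => (F.Gr x).Obj)

namespace Action

variable {Y : Type u} [TopologicalSpace Y] (a : F.Action Y)

/-- The domain of the multiplication maps of an `F`-action. -/
abbrev ActDomain {x x' : C} (g : x ⟶ x') : Type u :=
  {p : F.X g × Y // a.anchor p.2 = ⟨x, (F.X g).s p.1⟩}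

/-- The multiplication map of an `F`-action. -/
abbrev actMap {x x' : C} (g : x ⟶ x') (p : a.ActDomain g) : Y :=
  a.act g p.1.1 p.1.2 p.2

/-- `a.UltraAct g γ 𝒰 𝒱` says that the ultrafilter `𝒱` is `γ · 𝒰`. -/
def UltraAct {x x' : C} (g : x ⟶ x') (γ : F.X g) (𝒰 𝒱 : Ultrafilter Y) : Prop :=
  ∃ 𝒲 : Ultrafilter (a.ActDomain g), Tendsto (fun p : a.ActDomain g => p.1.1) 𝒲 (𝓝 γ) ∧
    𝒲.map (fun p : a.ActDomain g => p.1.2) = 𝒰 ∧ 𝒲.map (a.actMap g) = 𝒱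

variable {a} {x x' : C} {g : x ⟶ x'} {γ γ' : F.X g} {𝒰 𝒰' 𝒱 𝒱' : Ultrafilter Y}

/-- Since `s` is open, most points of `𝒰` have an anchor of the form `s γ'` with `γ'` close to `γ`.
-/
theorem exists_ultraAct (h : Tendsto a.anchor 𝒰 (𝓝 ⟨x, (F.X g).s γ⟩)) :
    ∃ 𝒱, a.UltraAct g γ 𝒰 𝒱 := by
  obtain ⟨𝒲, h1, h2⟩ := Ultrafilter.exists_le_map_eq
    (m := fun p : a.ActDomain g => p.1.2) (𝒰 := 𝒰) (l := comap (fun p => p.1.1) (𝓝 γ)) (by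
      rintro N ⟨T, hT, hN⟩
      have h3 : (fun γ => (⟨x, (F.X g).s γ⟩ : F.ObjSpace)) '' T ∈ 𝓝 ⟨x, (F.X g).s γ⟩ :=
        ((F.isOpenEmbedding_mk x).isOpenMap.comp (isOpenMap_s g)).image_mem_nhds hT
      filter_upwards [h h3]
      rintro y ⟨γ', hγ', e⟩
      exact ⟨⟨(γ', y), e.symm⟩, hN hγ', rfl⟩)
  exact ⟨_, 𝒲, tendsto_iff_comap.mpr h1, h2, rfl⟩

/-- Over a slice around `γ` the projection to `Y` is injective, so the witnessing ultrafilter is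
determined by `𝒰`. In `left_unique` the multiplication map takes the place of the projection. -/
theorem UltraAct.right_unique (h : a.UltraAct g γ 𝒰 𝒱) (h' : a.UltraAct g γ 𝒰 𝒱') : 𝒱 = 𝒱' := by
  obtain ⟨𝒲, h1, h2, rfl⟩ := h
  obtain ⟨𝒲', h1', h2', rfl⟩ := h'
  obtain ⟨S, -, hγS, hS, h3, -⟩ := exists_slice g γ isOpen_univ trivial
  rw [Ultrafilter.eq_of_map_eq_of_injOn (h2.trans h2'.symm) (E := (fun p => p.1.1) ⁻¹' S) ?_
    (h1 (hS.mem_nhds hγS)) (h1' (hS.mem_nhds hγS))]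
  rintro ⟨⟨γ₁, y₁⟩, e₁⟩ hγ₁ ⟨⟨γ₂, y₂⟩, e₂⟩ hγ₂ (rfl : y₁ = y₂)
  obtain rfl : γ₁ = γ₂ := h3 hγ₁ hγ₂ (a.s_eq_s e₁ e₂)
  rfl

theorem UltraAct.left_unique (h : a.UltraAct g γ 𝒰 𝒱) (h' : a.UltraAct g γ 𝒰' 𝒱) : 𝒰 = 𝒰' := by
  obtain ⟨𝒲, h1, rfl, h2⟩ := h
  obtain ⟨𝒲', h1', rfl, h2'⟩ := h'
  obtain ⟨S, -, hγS, hS, -, h3⟩ := exists_slice g γ isOpen_univ trivial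
  rw [Ultrafilter.eq_of_map_eq_of_injOn (h2.trans h2'.symm) (E := (fun p => p.1.1) ⁻¹' S) ?_
    (h1 (hS.mem_nhds hγS)) (h1' (hS.mem_nhds hγS))]
  rintro ⟨⟨γ₁, y₁⟩, e₁⟩ hγ₁ ⟨⟨γ₂, y₂⟩, e₂⟩ hγ₂ h
  obtain ⟨rfl, rfl⟩ := eq_and_eq_of_act_eq h3 hγ₁ hγ₂ h
  rfl

theorem UltraAct.tendsto_left (h : a.UltraAct g γ 𝒰 𝒱) :
    Tendsto a.anchor 𝒰 (𝓝 ⟨x, (F.X g).s γ⟩) := by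
  obtain ⟨𝒲, h1, rfl, -⟩ := h
  rw [Ultrafilter.coe_map, tendsto_map'_iff]
  have : (a.anchor ∘ fun p : a.ActDomain g => p.1.2) =
    (fun γ => (⟨x, (F.X g).s γ⟩ : F.ObjSpace)) ∘ fun p => p.1.1 := funext fun p => p.2
  rw [this]
  exact (((F.isOpenEmbedding_mk x).continuous.comp (continuous_s g)).tendsto γ).comp h1

theorem UltraAct.tendsto_right (h : a.UltraAct g γ 𝒰 𝒱) :
    Tendsto a.anchor 𝒱 (𝓝 ⟨x', (F.X g).r γ⟩) := by
  obtain ⟨𝒲, h1, -, rfl⟩ := h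
  rw [Ultrafilter.coe_map, tendsto_map'_iff]
  have : a.anchor ∘ a.actMap g = (fun γ => (⟨x', (F.X g).r γ⟩ : F.ObjSpace)) ∘ fun p => p.1.1 :=
    funext fun p => a.anchor_act g _ _ p.2
  rw [this]
  exact (((F.isOpenEmbedding_mk x').continuous.comp (continuous_r g)).tendsto γ).comp h1

/-- Amalgamate the two witnesses over the intermediate point of `Y`, then multiply the two arrows by
the continuous map `F.mul`. -/
theorem UltraAct.mul {x y z : C} {g : y ⟶ z} {h : x ⟶ y} {k : x ⟶ z} (hk : h ≫ g = k)
    {γ₁ : F.X g} {γ₂ : F.X h} {𝒰 𝒱 𝒲 : Ultrafilter Y} (e : (F.X g).s γ₁ = (F.X h).r γ₂)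
    (h1 : a.UltraAct h γ₂ 𝒰 𝒱) (h2 : a.UltraAct g γ₁ 𝒱 𝒲) :
    a.UltraAct k (F.mul g h k hk (.mk γ₁ γ₂ e)) 𝒰 𝒲 := by
  obtain ⟨𝒮, h3, rfl, rfl⟩ := h1
  obtain ⟨𝒮', h4, h5, rfl⟩ := h2
  obtain ⟨𝒯, rfl, rfl⟩ := Ultrafilter.exists_amalgam h5.symm
  have hs : ∀ p : {p : a.ActDomain h × a.ActDomain g // a.actMap h p.1 = p.2.1.2},
      (F.X g).s p.1.2.1.1 = (F.X h).r p.1.1.1.1 := by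
    rintro ⟨⟨⟨⟨γ, w⟩, e⟩, ⟨⟨γ', w'⟩, e'⟩⟩, h⟩
    dsimp only at e e' h ⊢
    subst h
    exact a.s_eq_s e' (a.anchor_act _ γ w e)
  have hw : ∀ p : {p : a.ActDomain h × a.ActDomain g // a.actMap h p.1 = p.2.1.2},
      a.anchor p.1.1.1.2 = ⟨x, (F.X k).s (F.mul g h k hk (.mk p.1.2.1.1 p.1.1.1.1 (hs p)))⟩ :=
    fun p => p.1.1.2.trans (congrArg (Sigma.mk x) (F.s_mul g h k hk _ _ (hs p)).symm)
  refine ⟨𝒯.map fun p => ⟨(F.mul g h k hk (.mk p.1.2.1.1 p.1.1.1.1 (hs p)), p.1.1.1.2), hw p⟩,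
    ?_, ?_, ?_⟩
  · rw [Ultrafilter.coe_map, tendsto_map'_iff]
    have hc : Continuous fun q : (F.X g).FibreProduct (F.X h) =>
        F.mul g h k hk (Quotient.mk ((F.X g).compSetoid (F.X h)) q) :=
      (F.mul g h k hk).continuous.comp continuous_quotient_mk'
    refine (hc.tendsto ⟨(γ₁, γ₂), e⟩).comp (f := fun p => ⟨(p.1.2.1.1, p.1.1.1.1), hs p⟩) ?_
    refine tendsto_subtype_rng.mpr ?_
    rw [Ultrafilter.coe_map, tendsto_map'_iff] at h3 h4
    exact Tendsto.prodMk_nhds h4 h3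
  · rw [Ultrafilter.map_map, Ultrafilter.map_map]
    rfl
  · rw [Ultrafilter.map_map, Ultrafilter.map_map]
    congr 1
    funext p
    have h6 := p.2
    have h7 : a.anchor (a.actMap h p.1.1) = ⟨y, (F.X g).s p.1.2.1.1⟩ := h6 ▸ p.1.2.2
    exact (a.mul_act g h k hk _ _ _ (hs p) p.1.1.2).symm.trans (a.act_congr rfl h6 h7 p.1.2.2)

/-- Factor the points of `𝒱` arbitrarily as `γ' · y`. The orbits of the `γ'` have convergent image
in the object space, so properness gives a limit orbit, and the factorisations can be corrected by
groupoid arrows so that `γ'` itself converges. -/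
theorem exists_ultraAct_of_isProper (hp : F.IsProper) {b : (F.Gr x').Obj}
    (h : Tendsto a.anchor 𝒱 (𝓝 ⟨x', b⟩)) (g : x ⟶ x') : ∃ γ 𝒰, a.UltraAct g γ 𝒰 𝒱 := by
  obtain ⟨𝒲, -, rfl⟩ := Ultrafilter.exists_le_map_eq (m := a.actMap g) (𝒰 := 𝒱) (l := ⊤) (by
    rintro N hN
    obtain rfl := mem_top.mp hN
    have h1 := (F.isOpenEmbedding_mk x').isOpen_range.mem_nhds ⟨b, rfl⟩
    filter_upwards [h h1]
    rintro y ⟨b', hb'⟩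
    obtain ⟨γ, z, e, rfl⟩ := a.surjective_act g y (by rw [← hb'])
    exact ⟨⟨(γ, z), e⟩, trivial, rfl⟩)
  have hr : Tendsto (F.X g).orbitAnchor (𝒲.map fun p => (F.X g).right.orbit p.1.1) (𝓝 b) := by
    rw [Ultrafilter.coe_map, tendsto_map'_iff,
      (F.isOpenEmbedding_mk x').isInducing.tendsto_nhds_iff]
    rw [Ultrafilter.coe_map, tendsto_map'_iff] at h
    convert h using 1
    funext p
    exact (a.anchor_act g _ _ p.2).symm
  obtain ⟨ξ, -, hξ⟩ := (isProperMap_iff_ultrafilter.mp (hp g)).2 hr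
  obtain ⟨γ, rfl⟩ : ∃ γ, (F.X g).right.orbit γ = ξ := Quotient.exists_rep ξ
  obtain ⟨𝒲', h1, h2⟩ := Ultrafilter.exists_le_map_eq (m := a.actMap g)
    (𝒰 := 𝒲.map (a.actMap g)) (l := comap (fun p => p.1.1) (𝓝 γ)) (by
      rintro N ⟨T, hT, hN⟩
      -- The orbit projection is open, so for most pairs the orbit of `γ'` contains some `γ''` near
      -- `γ`; the connecting arrow `η` is moved onto `y`.
      have h3 := hξ ((F.X g).right.isOpenMap_orbit.image_mem_nhds hT)
      rw [Ultrafilter.mem_coe, Ultrafilter.mem_map] at h3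
      rw [Ultrafilter.mem_map]
      filter_upwards [h3]
      rintro ⟨⟨γ', y⟩, e⟩ ⟨γ'', h4, h5⟩
      obtain ⟨η, h6, h7⟩ := (F.X g).right.orbit_eq_iff.mp h5
      have h8 : a.anchor y = ⟨x, (F.X (𝟙 x)).s (F.one x η)⟩ := by
        refine e.trans (congrArg (Sigma.mk x) ?_)
        rw [F.s_one, ← (F.X g).right.anchor_act γ'' η h6, h7]
        rfl
      refine ⟨⟨(γ'', a.act (𝟙 x) (F.one x η) y h8), a.anchor_act_one h6 h8⟩, hN h4, ?_⟩
      exact (a.act_act_one g γ'' η y h6 h8 _ (by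
        rw [show (F.X g).right.act γ'' η h6 = γ' from h7]; exact e)).trans
        (a.act_congr h7 rfl _ _))
  exact ⟨γ, _, 𝒲', tendsto_iff_comap.mpr h1, rfl, h2⟩

/-- On an amalgam of the two factorisations the two orbits agree pointwise, so their limits agree in
the Hausdorff orbit space. -/
theorem UltraAct.orbit_eq [T2Space (F.X g).right.OrbitSpace] (h : a.UltraAct g γ 𝒰 𝒱)
    (h' : a.UltraAct g γ' 𝒰' 𝒱) : (F.X g).right.orbit γ = (F.X g).right.orbit γ' := by
  obtain ⟨𝒲, h1, -, h2⟩ := h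
  obtain ⟨𝒲', h1', -, h2'⟩ := h'
  obtain ⟨𝒯, rfl, rfl⟩ := Ultrafilter.exists_amalgam (h2.trans h2'.symm)
  rw [Ultrafilter.coe_map, tendsto_map'_iff] at h1 h1'
  have hc := (F.X g).right.continuous_orbit
  refine tendsto_nhds_unique ((hc.tendsto γ).comp h1) (((hc.tendsto γ').comp h1').congr ?_)
  rintro ⟨⟨⟨⟨γ₁, y₁⟩, e₁⟩, ⟨⟨γ₂, y₂⟩, e₂⟩⟩, h⟩
  obtain ⟨η, h3, -, h4, -⟩ := a.exists_of_act_eq g γ₁ γ₂ y₁ y₂ e₁ e₂ h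
  exact ((F.X g).right.orbit_eq_iff.mpr ⟨η, h3, h4.symm⟩).symm

variable (a) in
/-- The ultrafilters along which the anchor map converges. -/
def ConvUltrafilter : Type u :=
  {𝒰 : Ultrafilter Y // ∃ b, Tendsto a.anchor 𝒰 (𝓝 b)}

namespace ConvUltrafilter

/-- Codes do not depend on the topology of the action, and the discrete one makes all continuity and
openness conditions trivial. -/
instance : TopologicalSpace a.ConvUltrafilter := ⊥

instance : DiscreteTopology a.ConvUltrafilter := ⟨rfl⟩

/-- The limit of the anchor map along an ultrafilter. -/
noncomputable def anchor (𝒰 : a.ConvUltrafilter) : F.ObjSpace :=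
  𝒰.2.choose

theorem tendsto_anchor (𝒰 : a.ConvUltrafilter) : Tendsto a.anchor 𝒰.1 (𝓝 𝒰.anchor) :=
  𝒰.2.choose_spec

theorem anchor_eq (hl : F.IsLocallyCompact) {𝒰 : a.ConvUltrafilter} {b : F.ObjSpace}
    (h : Tendsto a.anchor 𝒰.1 (𝓝 b)) : 𝒰.anchor = b :=
  have := hl.t2Space
  tendsto_nhds_unique 𝒰.tendsto_anchor h

/-- The product `γ · 𝒰`. -/
noncomputable def act (g : x ⟶ x') (γ : F.X g) (𝒰 : a.ConvUltrafilter)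
    (e : 𝒰.anchor = ⟨x, (F.X g).s γ⟩) : a.ConvUltrafilter :=
  ⟨(exists_ultraAct (e ▸ 𝒰.tendsto_anchor)).choose, _,
    (exists_ultraAct (e ▸ 𝒰.tendsto_anchor)).choose_spec.tendsto_right⟩

theorem ultraAct_act (g : x ⟶ x') (γ : F.X g) (𝒰 : a.ConvUltrafilter)
    (e : 𝒰.anchor = ⟨x, (F.X g).s γ⟩) : a.UltraAct g γ 𝒰.1 (act g γ 𝒰 e).1 :=
  (exists_ultraAct (e ▸ 𝒰.tendsto_anchor)).choose_spec

theorem act_eq {𝒰 𝒱 : a.ConvUltrafilter} (e : 𝒰.anchor = ⟨x, (F.X g).s γ⟩)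
    (h : a.UltraAct g γ 𝒰.1 𝒱.1) : act g γ 𝒰 e = 𝒱 :=
  Subtype.ext ((ultraAct_act g γ 𝒰 e).right_unique h)

end ConvUltrafilter

variable (a) in
/-- The `F`-action on the discrete set of ultrafilters along which the anchor map converges. -/
noncomputable def convUltrafilter (hp : F.IsProper) (hl : F.IsLocallyCompact) :
    F.Action a.ConvUltrafilter where
  anchor := ConvUltrafilter.anchor
  continuous_anchor := continuous_of_discreteTopology
  act := ConvUltrafilter.act
  anchor_act g γ 𝒰 e := ConvUltrafilter.anchor_eq hl
    (ConvUltrafilter.ultraAct_act g γ 𝒰 e).tendsto_right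
  continuous_act g := continuous_of_slices fun _ _ _ _ _ _ => isOpen_discrete _
  isOpenMap_act g := fun _ _ => isOpen_discrete _
  surjective_act := by
    rintro x x' g 𝒱 rfl
    obtain ⟨γ, 𝒰, h⟩ := exists_ultraAct_of_isProper hp 𝒱.tendsto_anchor g
    exact ⟨γ, ⟨𝒰, _, h.tendsto_left⟩, ConvUltrafilter.anchor_eq hl h.tendsto_left,
      ConvUltrafilter.act_eq _ h⟩
  mul_act g h k hk γ₁ γ₂ 𝒰 e e' := (ConvUltrafilter.act_eq _
    (.mul hk e (ConvUltrafilter.ultraAct_act _ _ _ _) (ConvUltrafilter.ultraAct_act _ _ _ _))).symm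
  exists_of_act_eq := by
    intro x x' g γ γ' 𝒰 𝒰' e e' h
    have := (hl.2 g).2.2
    have h1 := ConvUltrafilter.ultraAct_act g γ 𝒰 e
    have h2 := ConvUltrafilter.ultraAct_act g γ' 𝒰' e'
    rw [← h] at h2
    obtain ⟨η, h3, rfl⟩ := (F.X g).right.orbit_eq_iff.mp (h1.orbit_eq h2)
    have h4 : 𝒰'.anchor = ⟨x, (F.X (𝟙 x)).s (F.one x η)⟩ := by
      refine e'.trans (congrArg (Sigma.mk x) ?_)
      rw [F.s_one]
      exact (F.X g).right.anchor_act γ η h3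
    refine ⟨η, h3, h4, rfl, Subtype.ext ?_⟩
    -- Multiplying `η · 𝒰'` by `γ` gives `γ' · 𝒰' = γ · 𝒰`, so left uniqueness identifies it with
    -- `𝒰`.
    have h5 := ConvUltrafilter.ultraAct_act (𝟙 x) (F.one x η) 𝒰' h4
    have h6 : Tendsto a.anchor (ConvUltrafilter.act (𝟙 x) (F.one x η) 𝒰' h4).1
        (𝓝 ⟨x, (F.X g).s γ⟩) := by
      have := h5.tendsto_right
      rw [F.r_one] at this
      exact this.mono_right (le_of_eq (by rw [← h3]; rfl))
    obtain ⟨𝒱, h7⟩ := exists_ultraAct h6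
    have h8 := UltraAct.mul (Category.id_comp g) (h3.trans (F.r_one x η).symm) h5 h7
    rw [F.mul_one g γ η h3] at h8
    rw [h8.right_unique h2] at h7
    exact h1.left_unique h7

variable (hp : F.IsProper) (hl : F.IsLocallyCompact)

/-- A relation between ultrafilters is realised pointwise on a large set, because the arrows in the
witness eventually lie in the open slice. -/
theorem LetterRel.mem_of_convUltrafilter {l : Bool × F.Slice} {𝒰 𝒱 : a.ConvUltrafilter}
    (h : (a.convUltrafilter hp hl).LetterRel l 𝒰 𝒱) {A : Set Y} (hA : A ∈ 𝒱.1) :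
    {y | ∃ z ∈ A, a.LetterRel l y z} ∈ 𝒰.1 := by
  obtain ⟨_ | _, S⟩ := l
  · obtain ⟨γ, hγ, e, rfl⟩ := h
    obtain ⟨𝒲, h1, h2, h3⟩ := ConvUltrafilter.ultraAct_act S.hom γ 𝒱 e
    rw [← h2] at hA
    change _ ∈ (ConvUltrafilter.act S.hom γ 𝒱 e).1
    rw [← h3]
    rw [Ultrafilter.mem_map] at hA ⊢
    filter_upwards [hA, h1 (S.isOpen.mem_nhds hγ)]
    rintro ⟨⟨γ', y⟩, e'⟩ h4 h5
    exact ⟨y, h4, γ', h5, e', rfl⟩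
  · obtain ⟨γ, hγ, e, rfl⟩ := h
    obtain ⟨𝒲, h1, h2, h3⟩ := ConvUltrafilter.ultraAct_act S.hom γ 𝒰 e
    change A ∈ (ConvUltrafilter.act S.hom γ 𝒰 e).1 at hA
    rw [← h3] at hA
    rw [← h2]
    rw [Ultrafilter.mem_map] at hA ⊢
    filter_upwards [hA, h1 (S.isOpen.mem_nhds hγ)]
    rintro ⟨⟨γ', y⟩, e'⟩ h4 h5
    exact ⟨_, h4, γ', h5, e', rfl⟩

theorem WordRel.mem_of_convUltrafilter {w : F.SliceWord} {𝒰 𝒱 : a.ConvUltrafilter}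
    (h : (a.convUltrafilter hp hl).WordRel w 𝒰 𝒱) {A : Set Y} (hA : A ∈ 𝒱.1) :
    {y | ∃ z ∈ A, a.WordRel w y z} ∈ 𝒰.1 := by
  induction w generalizing 𝒰 with
  | nil =>
    obtain rfl : 𝒰 = 𝒱 := h
    simpa [WordRel] using hA
  | cons l w ih =>
    obtain ⟨𝒯, h1, h2⟩ := h
    filter_upwards [h1.mem_of_convUltrafilter hp hl (ih h2)]
    rintro y ⟨t, ⟨z, hz, h3⟩, h4⟩
    exact ⟨z, hz, t, h4, h3⟩

variable (a) in
-- Continuity of the multiplication gives `γ · 𝒰 → γ · y`. Openness lifts an ultrafilter converging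
-- to `γ · z` to one converging to `(γ, z)`.
theorem isBisimulation_convUltrafilter : IsBisimulation (a.convUltrafilter hp hl) a
    fun 𝒰 y => ↑𝒰.1 ≤ 𝓝 y where
  anchor_eq {𝒰 y} h := ConvUltrafilter.anchor_eq hl ((a.continuous_anchor.tendsto y).mono_left h)
  act := by
    intro 𝒰 y h x x' g γ e e'
    obtain ⟨𝒲, h1, h2, h3⟩ := ConvUltrafilter.ultraAct_act g γ 𝒰 e
    change ((ConvUltrafilter.act g γ 𝒰 e).1 : Filter Y) ≤ _
    rw [← h3]
    rw [← h2] at h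
    have h4 : Tendsto id (𝒲 : Filter (a.ActDomain g)) (𝓝 ⟨(γ, y), e'⟩) :=
      tendsto_subtype_rng.mpr (Tendsto.prodMk_nhds h1 h)
    exact ((a.continuous_act g).tendsto _).comp h4
  exists_act := by
    intro 𝒱 y h x x' g hx
    have hy : a.anchor y = (a.convUltrafilter hp hl).anchor 𝒱 :=
      (ConvUltrafilter.anchor_eq hl ((a.continuous_anchor.tendsto y).mono_left h)).symm
    obtain ⟨γ, z, e, rfl⟩ := a.surjective_act g y (by rw [hy]; exact hx)
    obtain ⟨𝒲, h1, h2⟩ := Ultrafilter.exists_le_map_eq (m := a.actMap g) (𝒰 := 𝒱.1)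
      (l := 𝓝 ⟨(γ, z), e⟩) fun N hN => h ((a.isOpenMap_act g).image_mem_nhds hN)
    have h3 : a.UltraAct g γ (𝒲.map fun p => p.1.2) 𝒱.1 :=
      ⟨𝒲, ((continuous_fst.comp continuous_subtype_val).tendsto _).mono_left h1, rfl, h2⟩
    let 𝒰 : a.ConvUltrafilter := ⟨_, _, h3.tendsto_left⟩
    have h4 : 𝒰.anchor = ⟨x, (F.X g).s γ⟩ := ConvUltrafilter.anchor_eq hl h3.tendsto_left
    refine ⟨γ, 𝒰, z, h4, e, ConvUltrafilter.act_eq h4 h3, rfl, ?_⟩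
    exact ((continuous_snd.comp continuous_subtype_val).tendsto _).mono_left h1

end Action

/-! ### Properness, Hausdorffness and local compactness -/

namespace CodeSpace

/-- If the code of `𝒰` lies in a generating set, the word that shows this for `𝒰` also shows it for
most points of `𝒰`, and those points are their own codes. -/
theorem convUltrafilter_le_nhds (hp : F.IsProper) (hl : F.IsLocallyCompact)
    (𝒰 : (action F).ConvUltrafilter) :
    ↑𝒰.1 ≤ 𝓝 (((action F).convUltrafilter hp hl).toCode 𝒰) := by
  rw [TopologicalSpace.nhds_generateFrom]
  refine le_iInf₂ ?_
  rintro _ ⟨hκ, w, V, hV, rfl⟩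
  rw [le_principal_iff]
  obtain ⟨𝒱, h1, h2⟩ := toCode_mem_basicOpen.mp hκ
  have h3 := h2.mem_of_convUltrafilter hp hl (𝒱.tendsto_anchor (hV.mem_nhds h1))
  filter_upwards [h3] with κ h4
  rw [← Action.toCode_action κ]
  exact toCode_mem_basicOpen.mpr h4

theorem isProperMap_anchor (hp : F.IsProper) (hl : F.IsLocallyCompact) :
    IsProperMap (anchor : F.CodeSpace → F.ObjSpace) := by
  have := hl.t2Space
  refine isProperMap_iff_ultrafilter_of_t2.mpr ⟨continuous_anchor, fun 𝒰 b hb => ?_⟩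
  exact ⟨_, convUltrafilter_le_nhds hp hl ⟨𝒰, b, hb⟩⟩

/-- Convergence is a bisimulation, so every limit of an ultrafilter must be its code. -/
theorem t2Space (hp : F.IsProper) (hl : F.IsLocallyCompact) : T2Space F.CodeSpace := by
  refine t2_iff_ultrafilter.mpr ?_
  have key : ∀ (κ : F.CodeSpace) (𝒰 : (action F).ConvUltrafilter), ↑𝒰.1 ≤ 𝓝 κ →
      ((action F).convUltrafilter hp hl).toCode 𝒰 = κ := fun κ 𝒰 h => by
    rw [← Action.toCode_action κ, Action.toCode_eq_iff]
    exact ((action F).isBisimulation_convUltrafilter hp hl).code_eq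
      h
  intro κ κ' 𝒰 h h'
  have hb := (continuous_anchor.tendsto κ).mono_left h
  rw [← key κ ⟨𝒰, _, hb⟩ h, ← key κ' ⟨𝒰, _, hb⟩ h']

end CodeSpace

theorem weaklyLocallyCompactSpace_of_isProperMap {Y : Type u} [TopologicalSpace Y]
    (hl : F.IsLocallyCompact) {f : Y → F.ObjSpace} (hf : IsProperMap f) :
    WeaklyLocallyCompactSpace Y := by
  refine ⟨fun y => ?_⟩
  obtain ⟨⟨x, b⟩, hb⟩ : ∃ p, f y = p := ⟨_, rfl⟩
  have := (hl.1 x).2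
  obtain ⟨K, hK, hbK⟩ := exists_compact_mem_nhds b
  refine ⟨_, hf.isCompact_preimage (hK.image (F.isOpenEmbedding_mk x).continuous),
    hf.continuous.continuousAt ?_⟩
  rw [hb]
  exact (F.isOpenEmbedding_mk x).isOpenMap.image_mem_nhds hbK

end CorrespondenceDiagram

/-! ### Germs of words -/

namespace CorrespondenceDiagram

variable {C : Type u} [SmallCategory C] {F : CorrespondenceDiagram C}

theorem SliceWord.inv_inv (w : F.SliceWord) : w.inv.inv = w := by
  simp [SliceWord.inv, Function.comp_def]

namespace Action

variable {Y : Type u} [TopologicalSpace Y] {a : F.Action Y}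

theorem WordRel.left_unique {w : F.SliceWord} {y y' z : Y} (h : a.WordRel w y z)
    (h' : a.WordRel w y' z) : y = y' :=
  (wordRel_inv.mpr h).right_unique (wordRel_inv.mpr h')

theorem WordRel.toCode {w : F.SliceWord} {y z : Y} (h : a.WordRel w y z) :
    (CodeSpace.action F).WordRel w (a.toCode y) (a.toCode z) := by
  obtain ⟨z', h1, rfl⟩ := a.isEquivariant_toCode.isBisimulation.exists_wordRel rfl h
  exact h1

/-- Whether a word is defined at a point depends only on its code; this lets germs over `CodeSpace`
act on all `F`-actions. -/
theorem exists_wordRel_of_toCode {w : F.SliceWord} {y : Y} {β : F.CodeSpace}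
    (h : (CodeSpace.action F).WordRel w (a.toCode y) β) : ∃ z, a.WordRel w y z ∧ a.toCode z = β :=
  a.isEquivariant_toCode.isBisimulation.flip.exists_wordRel (y := a.toCode y) (y' := y) rfl h

end Action

namespace SliceWord

/-- The domain of a word, as a subset of the space of codes. -/
def dom (w : F.SliceWord) : Set F.CodeSpace :=
  {α | ∃ β, (CodeSpace.action F).WordRel w α β}

theorem isOpen_dom (w : F.SliceWord) : IsOpen w.dom := by
  simpa [dom] using (CodeSpace.action F).isOpen_wordRel w isOpen_univ

/-- Two words agree over a code if they act equally on all points with this code. -/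
def Agree (w w' : F.SliceWord) (α : F.CodeSpace) : Prop :=
  ∀ (Y : Type u) [TopologicalSpace Y] (a : F.Action Y) (y z : Y), a.toCode y = α →
    (a.WordRel w y z ↔ a.WordRel w' y z)

/-- Two words have the same germ at a code if they agree in a neighbourhood. -/
def GermEq (w w' : F.SliceWord) (α : F.CodeSpace) : Prop :=
  ∀ᶠ β in 𝓝 α, Agree w w' β

variable {w w' w₁ w₁' : F.SliceWord} {α β : F.CodeSpace}

theorem GermEq.refl (w : F.SliceWord) (α : F.CodeSpace) : GermEq w w α :=
  Filter.Eventually.of_forall fun _ _ _ _ _ _ _ => Iff.rfl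

theorem GermEq.symm (h : GermEq w w' α) : GermEq w' w α :=
  h.mono fun _ h Y _ a y z hy => (h Y a y z hy).symm

theorem GermEq.trans (h : GermEq w w' α) (h' : GermEq w' w₁ α) : GermEq w w₁ α := by
  filter_upwards [h, h'] with β h h' Y _ a y z hy
  exact (h Y a y z hy).trans (h' Y a y z hy)

theorem isOpen_germEq (w w' : F.SliceWord) : IsOpen {α | GermEq w w' α} :=
  isOpen_setOfPred_eventually_nhds

theorem GermEq.wordRel_iff (h : GermEq w w' α) :
    (CodeSpace.action F).WordRel w α β ↔ (CodeSpace.action F).WordRel w' α β :=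
  h.self_of_nhds _ _ _ _ (Action.toCode_action α)

theorem GermEq.append (h : GermEq w w' α) (h₁ : GermEq w₁ w₁' β)
    (hβ : (CodeSpace.action F).WordRel w α β) : GermEq (w ++ w₁) (w' ++ w₁') α := by
  obtain ⟨O, hO, ho, hβO⟩ := eventually_nhds_iff.mp h₁
  filter_upwards [h, ((CodeSpace.action F).isOpen_wordRel w ho).mem_nhds ⟨β, hβO, hβ⟩]
  rintro α' h1 ⟨β', hβ', h2⟩ Y _ a y z rfl
  rw [Action.wordRel_append, Action.wordRel_append]
  refine exists_congr fun t => ?_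
  rw [← h1 Y a y t rfl]
  refine and_congr_right fun h3 => hO _ hβ' Y a t z ?_
  exact h3.toCode.right_unique h2

theorem GermEq.inv (h : GermEq w w' α) (hβ : (CodeSpace.action F).WordRel w α β) :
    GermEq w.inv w'.inv β := by
  obtain ⟨O, hO, ho, hαO⟩ := eventually_nhds_iff.mp h
  filter_upwards [((CodeSpace.action F).isOpen_wordRel w.inv ho).mem_nhds
    ⟨α, hαO, Action.wordRel_inv.mpr hβ⟩]
  rintro β' ⟨α', hα', h2⟩ Y _ a y z rfl
  obtain ⟨t, h3, rfl⟩ := Action.exists_wordRel_of_toCode h2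
  rw [Action.wordRel_inv] at h3
  have h4 := (hO _ hα' Y a t y rfl).mp h3
  rw [Action.wordRel_inv, Action.wordRel_inv]
  constructor
  · intro h5
    rwa [h5.left_unique h3]
  · intro h5
    rwa [h5.left_unique h4]

theorem germEq_append_inv (h : α ∈ w.dom) : GermEq (w ++ w.inv) [] α := by
  filter_upwards [w.isOpen_dom.mem_nhds h]
  rintro α' ⟨β', h1⟩ Y _ a y z rfl
  obtain ⟨t, h2, -⟩ := Action.exists_wordRel_of_toCode h1
  rw [Action.wordRel_append]
  constructor
  · rintro ⟨t', h3, h4⟩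
    exact h3.left_unique (Action.wordRel_inv.mp h4)
  · rintro (rfl : y = z)
    exact ⟨t, h2, Action.wordRel_inv.mpr h2⟩

end SliceWord

open SliceWord

variable (F) in
/-- The equivalence relation of having the same germ. -/
def germSetoid : Setoid {p : F.SliceWord × F.CodeSpace // p.2 ∈ p.1.dom} where
  r p q := p.1.2 = q.1.2 ∧ GermEq p.1.1 q.1.1 p.1.2
  iseqv :=
    { refl := fun _ => ⟨rfl, .refl _ _⟩
      symm := fun h => ⟨h.1.symm, h.1 ▸ h.2.symm⟩
      trans := fun h h' => ⟨h.1.trans h'.1, h.2.trans (h.1 ▸ h'.2)⟩ }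

variable (F) in
/-- Germs of words at points of the space of codes. -/
def Germ : Type u :=
  Quotient F.germSetoid

/-! ### The étale groupoid of germs -/

namespace Germ

/-- The germ of a word at a point. -/
def mk (w : F.SliceWord) (α : F.CodeSpace) (h : α ∈ w.dom) : F.Germ :=
  Quotient.mk F.germSetoid ⟨(w, α), h⟩

theorem mk_eq_iff {w w' : F.SliceWord} {α α' : F.CodeSpace} {h : α ∈ w.dom} {h' : α' ∈ w'.dom} :
    mk w α h = mk w' α' h' ↔ α = α' ∧ GermEq w w' α :=
  Quotient.eq (r := F.germSetoid)

theorem mk_congr {w w' : F.SliceWord} {α α' : F.CodeSpace} (h : α ∈ w.dom) (h' : α' ∈ w'.dom)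
    (hw : w = w') (hα : α = α') : mk w α h = mk w' α' h' := by
  subst hw hα; rfl

theorem exists_mk (g : F.Germ) : ∃ w α h, mk w α h = g := by
  obtain ⟨⟨⟨w, α⟩, h⟩, rfl⟩ := Quotient.exists_rep g
  exact ⟨w, α, h, rfl⟩

/-- The source of a germ. -/
def s : F.Germ → F.CodeSpace :=
  Quotient.lift (fun p => p.1.2) fun _ _ h => h.1

/-- The range of a germ. -/
noncomputable def r : F.Germ → F.CodeSpace :=
  Quotient.lift (fun p => p.2.choose) (by
    rintro ⟨⟨w, α⟩, h⟩ ⟨⟨w', α'⟩, h'⟩ ⟨rfl : α = α', h2⟩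
    exact (h2.wordRel_iff.mp h.choose_spec).right_unique h'.choose_spec)

theorem wordRel_r (w : F.SliceWord) (α : F.CodeSpace) (h : α ∈ w.dom) :
    (CodeSpace.action F).WordRel w α (mk w α h).r :=
  h.choose_spec

theorem r_mk {w : F.SliceWord} {α β : F.CodeSpace}
    (hβ : (CodeSpace.action F).WordRel w α β) : (mk w α ⟨β, hβ⟩).r = β :=
  (wordRel_r w α ⟨β, hβ⟩).right_unique hβ

theorem append_mem_dom {w w' : F.SliceWord} {α β : F.CodeSpace} (h : α ∈ w.dom) (h' : β ∈ w'.dom)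
    (e : β = (mk w α h).r) : α ∈ dom (F := F) (w ++ w') := by
  subst e
  obtain ⟨γ, hγ⟩ := h'
  exact ⟨γ, Action.wordRel_append.mpr ⟨_, wordRel_r w α h, hγ⟩⟩

/-- The first letter of a word acts first, so the word of the right factor comes first in the
concatenation. -/
theorem exists_mul (g h : F.Germ) (e : g.s = h.r) : ∃ k : F.Germ, ∀ w' β hβ w α hα hα',
    g = mk w' β hβ → h = mk w α hα → k = mk (w ++ w') α hα' := by
  obtain ⟨w', β, hβ, rfl⟩ := g.exists_mk
  obtain ⟨w, α, hα, rfl⟩ := h.exists_mk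
  refine ⟨mk (w ++ w') α (append_mem_dom hα hβ e), ?_⟩
  intro w₁' β₁ hβ₁ w₁ α₁ hα₁ hα' h1 h2
  rw [mk_eq_iff] at h1 h2 ⊢
  refine ⟨h2.1, h2.2.append h1.2 ?_⟩
  rw [show β = _ from e]
  exact wordRel_r w α hα

/-- The product of germs. -/
noncomputable def mul (g h : F.Germ) (e : g.s = h.r) : F.Germ :=
  (exists_mul g h e).choose

theorem mul_mk {w w' : F.SliceWord} {α β : F.CodeSpace} (hα : α ∈ w.dom) (hβ : β ∈ w'.dom)
    (e : (mk w' β hβ).s = (mk w α hα).r) :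
    mul (mk w' β hβ) (mk w α hα) e = mk (w ++ w') α (append_mem_dom hα hβ e) :=
  (exists_mul _ _ e).choose_spec _ _ _ _ _ _ _ rfl rfl

theorem mul_congr {g g' h h' : F.Germ} (hg : g = g') (hh : h = h') (e : g.s = h.r)
    (e' : g'.s = h'.r) : mul g h e = mul g' h' e' := by
  subst hg hh; rfl

/-- The unit germs. -/
def unit (α : F.CodeSpace) : F.Germ :=
  mk [] α ⟨α, rfl⟩

theorem r_mem_dom_inv (w : F.SliceWord) (α : F.CodeSpace) (h : α ∈ w.dom) :
    (mk w α h).r ∈ w.inv.dom :=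
  ⟨α, Action.wordRel_inv.mpr (wordRel_r w α h)⟩

/-- The inverse of a germ. -/
noncomputable def inv : F.Germ → F.Germ :=
  Quotient.lift (fun p => mk p.1.1.inv (mk p.1.1 p.1.2 p.2).r (r_mem_dom_inv _ _ p.2)) (by
    rintro ⟨⟨w, α⟩, h⟩ ⟨⟨w', α'⟩, h'⟩ h1
    have h2 : mk w α h = mk w' α' h' := mk_eq_iff.mpr h1
    exact mk_eq_iff.mpr ⟨congrArg r h2, h1.2.inv (wordRel_r w α h)⟩)

theorem inv_mk (w : F.SliceWord) (α : F.CodeSpace) (h : α ∈ w.dom) :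
    (mk w α h).inv = mk w.inv (mk w α h).r (r_mem_dom_inv w α h) :=
  rfl

theorem r_mul (g h : F.Germ) (e : g.s = h.r) : (mul g h e).r = g.r := by
  obtain ⟨w', β, hβ, rfl⟩ := g.exists_mk
  obtain ⟨w, α, hα, rfl⟩ := h.exists_mk
  rw [mul_mk]
  obtain rfl : β = _ := e
  exact r_mk (Action.wordRel_append.mpr ⟨_, wordRel_r _ _ _, wordRel_r _ _ _⟩)

theorem s_mul (g h : F.Germ) (e : g.s = h.r) : (mul g h e).s = h.s := by
  obtain ⟨w', β, hβ, rfl⟩ := g.exists_mk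
  obtain ⟨w, α, hα, rfl⟩ := h.exists_mk
  rw [mul_mk]
  rfl

theorem mul_assoc (g h k : F.Germ) (e : g.s = h.r) (e' : h.s = k.r) :
    mul (mul g h e) k ((s_mul g h e).trans e') =
      mul g (mul h k e') (e.trans (r_mul h k e').symm) := by
  obtain ⟨w'', γ, hγ, rfl⟩ := g.exists_mk
  obtain ⟨w', β, hβ, rfl⟩ := h.exists_mk
  obtain ⟨w, α, hα, rfl⟩ := k.exists_mk
  have e₁ : γ = (mk (w ++ w') α (append_mem_dom hα hβ e')).r := by
    rw [← mul_mk hα hβ e', r_mul]; exact e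
  rw [mul_congr (mul_mk hβ hγ e) rfl _ e', mul_congr (g := mk w'' γ hγ) rfl (mul_mk hα hβ e') _ e₁]
  exact (mul_mk hα (append_mem_dom hβ hγ e) e').trans
    ((mk_congr _ _ (List.append_assoc _ _ _).symm rfl).trans (mul_mk _ hγ e₁).symm)

theorem r_unit (α : F.CodeSpace) : (unit α).r = α :=
  r_mk (w := []) rfl

theorem unit_mul (g : F.Germ) : mul (unit g.r) g rfl = g := by
  obtain ⟨w, α, hα, rfl⟩ := g.exists_mk
  exact (mul_mk hα _ rfl).trans (mk_congr _ _ (List.append_nil w) rfl)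

theorem mul_unit (g : F.Germ) : mul g (unit g.s) (r_unit g.s).symm = g := by
  obtain ⟨w, α, hα, rfl⟩ := g.exists_mk
  exact mul_mk _ hα _

theorem r_inv (g : F.Germ) : g.inv.r = g.s := by
  obtain ⟨w, α, hα, rfl⟩ := g.exists_mk
  exact r_mk (Action.wordRel_inv.mpr (wordRel_r w α hα))

theorem s_inv (g : F.Germ) : g.inv.s = g.r := by
  obtain ⟨w, α, hα, rfl⟩ := g.exists_mk
  rfl

theorem inv_inv (g : F.Germ) : g.inv.inv = g := by
  obtain ⟨w, α, hα, rfl⟩ := g.exists_mk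
  rw [inv_mk, inv_mk]
  exact mk_congr _ _ w.inv_inv (r_mk (Action.wordRel_inv.mpr (wordRel_r w α hα)))

theorem inv_mul (g : F.Germ) : mul g.inv g (s_inv g) = unit g.s := by
  obtain ⟨w, α, hα, rfl⟩ := g.exists_mk
  exact (mul_mk hα _ _).trans (mk_eq_iff.mpr ⟨rfl, germEq_append_inv hα⟩)

theorem mul_inv (g : F.Germ) : mul g g.inv (r_inv g).symm = unit g.r := by
  have h := inv_mul g.inv
  rw [mul_congr g.inv_inv rfl _ (r_inv g).symm, s_inv] at h
  exact h

/-- The finest topology for which all sections `α ↦ mk w α`, defined on the open domains of words,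
are continuous. -/
instance : TopologicalSpace F.Germ where
  IsOpen O := ∀ w : F.SliceWord, IsOpen {α | ∃ h : α ∈ w.dom, mk w α h ∈ O}
  isOpen_univ w := by simpa using w.isOpen_dom
  isOpen_inter O O' hO hO' w := by
    convert (hO w).inter (hO' w) using 1
    ext α
    constructor
    · rintro ⟨h, h1, h2⟩
      exact ⟨⟨h, h1⟩, ⟨h, h2⟩⟩
    · rintro ⟨⟨h, h1⟩, ⟨_, h2⟩⟩
      exact ⟨h, h1, h2⟩
  isOpen_sUnion s hs w := by
    convert isOpen_biUnion fun O hO => hs O hO w using 1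
    ext α
    simp only [Set.mem_sUnion, Set.mem_ofPred_eq, Set.mem_iUnion, exists_prop]
    constructor
    · rintro ⟨h, O, hO, h1⟩
      exact ⟨O, hO, h, h1⟩
    · rintro ⟨O, hO, h, h1⟩
      exact ⟨h, O, hO, h1⟩

theorem isOpen_iff {O : Set F.Germ} :
    IsOpen O ↔ ∀ w : F.SliceWord, IsOpen {α | ∃ h : α ∈ w.dom, mk w α h ∈ O} :=
  Iff.rfl

/-- The set of all germs of a word. -/
def bisection (w : F.SliceWord) : Set F.Germ :=
  {g | ∃ α h, mk w α h = g}

/-- Words with the same germ at a point have the same germ at all nearby points. -/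
theorem isOpen_bisection (w : F.SliceWord) : IsOpen (bisection w) := by
  refine isOpen_iff.mpr fun w' => ?_
  convert (w'.isOpen_dom.inter w.isOpen_dom).inter (isOpen_germEq w' w) using 1
  ext α
  constructor
  · rintro ⟨h, β, h1, h2⟩
    obtain ⟨rfl, h3⟩ := mk_eq_iff.mp h2
    exact ⟨⟨h, h1⟩, h3.symm⟩
  · rintro ⟨⟨h, h1⟩, h3⟩
    exact ⟨h, α, h1, mk_eq_iff.mpr ⟨rfl, h3.symm⟩⟩

theorem continuous_mk (w : F.SliceWord) : Continuous fun α : w.dom => mk w α.1 α.2 := by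
  refine continuous_def.mpr fun O hO => ?_
  convert (isOpen_iff.mp hO w).preimage continuous_subtype_val using 1
  ext α
  exact ⟨fun h => ⟨α.2, h⟩, fun h => h.2⟩

theorem continuous_s : Continuous (s : F.Germ → F.CodeSpace) := by
  refine continuous_def.mpr fun V hV => isOpen_iff.mpr fun w => ?_
  convert w.isOpen_dom.inter hV using 1
  ext α
  exact ⟨fun h => ⟨h.1, h.2⟩, fun h => ⟨h.1, h.2⟩⟩

theorem isOpenMap_s : IsOpenMap (s : F.Germ → F.CodeSpace) := by
  intro O hO
  have : s '' O = ⋃ w : F.SliceWord, {α | ∃ h : α ∈ w.dom, mk w α h ∈ O} := by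
    ext α
    simp only [Set.mem_iUnion, Set.mem_ofPred_eq]
    constructor
    · rintro ⟨g, hg, rfl⟩
      obtain ⟨w, α, hα, rfl⟩ := g.exists_mk
      exact ⟨w, hα, hg⟩
    · rintro ⟨w, h, hg⟩
      exact ⟨_, hg, rfl⟩
  rw [this]
  exact isOpen_iUnion (isOpen_iff.mp hO)

theorem isLocalHomeomorph_s : IsLocalHomeomorph (s : F.Germ → F.CodeSpace) := by
  refine isLocalHomeomorph_iff_isOpenEmbedding_restrict.mpr fun g => ?_
  obtain ⟨w, α, hα, rfl⟩ := g.exists_mk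
  refine ⟨bisection w, (isOpen_bisection w).mem_nhds ⟨α, hα, rfl⟩, ?_⟩
  refine .of_continuous_injective_isOpenMap (continuous_s.comp continuous_subtype_val) ?_
    (isOpenMap_s.domRestrict (isOpen_bisection w))
  rintro ⟨_, α₁, h₁, rfl⟩ ⟨_, α₂, h₂, rfl⟩ (rfl : α₁ = α₂)
  rfl

theorem continuous_inv : Continuous (inv : F.Germ → F.Germ) := by
  refine continuous_def.mpr fun O hO => isOpen_iff.mpr fun w => ?_
  convert (CodeSpace.action F).isOpen_wordRel w (isOpen_iff.mp hO w.inv) using 1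
  ext α
  constructor
  · rintro ⟨h, h1⟩
    exact ⟨_, ⟨_, h1⟩, wordRel_r w α h⟩
  · rintro ⟨β, ⟨h1, h2⟩, h3⟩
    have h4 : α ∈ w.dom := ⟨β, h3⟩
    refine ⟨h4, ?_⟩
    rw [Set.mem_preimage, inv_mk, mk_congr (r_mem_dom_inv w α h4) h1 rfl (r_mk h3)]
    exact h2

/-- Inversion of germs as a homeomorphism. -/
noncomputable def invHomeomorph : F.Germ ≃ₜ F.Germ where
  toFun := inv
  invFun := inv
  left_inv := inv_inv
  right_inv := inv_inv
  continuous_toFun := continuous_inv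
  continuous_invFun := continuous_inv

theorem isLocalHomeomorph_r : IsLocalHomeomorph (r : F.Germ → F.CodeSpace) := by
  have : (r : F.Germ → F.CodeSpace) = s ∘ invHomeomorph := funext fun g => (s_inv g).symm
  rw [this]
  exact isLocalHomeomorph_s.comp invHomeomorph.isLocalHomeomorph

theorem continuous_unit : Continuous (unit : F.CodeSpace → F.Germ) := by
  refine continuous_def.mpr fun O hO => ?_
  convert isOpen_iff.mp hO [] using 1
  ext α
  exact ⟨fun h => ⟨_, h⟩, fun h => h.2⟩

theorem continuous_mul :
    Continuous fun p : {p : F.Germ × F.Germ // p.1.s = p.2.r} => mul p.1.1 p.1.2 p.2 := by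
  refine continuous_def.mpr fun O hO => isOpen_iff_mem_nhds.mpr ?_
  rintro ⟨⟨g, h⟩, e⟩ hgh
  obtain ⟨w', β, hβ, rfl⟩ := g.exists_mk
  obtain ⟨w, α, hα, rfl⟩ := h.exists_mk
  rw [Set.mem_preimage] at hgh
  dsimp only at e hgh
  rw [mul_mk] at hgh
  -- On these bisections every product is a germ of the single word `w ++ w'`, so only its source
  -- matters.
  have h1 : IsOpen (bisection w' ×ˢ (bisection w ∩ s ⁻¹' _)) :=
    (isOpen_bisection w').prod ((isOpen_bisection w).inter
      ((isOpen_iff.mp hO (w ++ w')).preimage continuous_s))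
  filter_upwards [(h1.preimage continuous_subtype_val).mem_nhds
    (show (⟨(mk w' β hβ, mk w α hα), e⟩ : {p : F.Germ × F.Germ // p.1.s = p.2.r}) ∈ _ from
      ⟨⟨β, hβ, rfl⟩, ⟨α, hα, rfl⟩, _, hgh⟩)]
  rintro ⟨⟨_, _⟩, e₁⟩ ⟨⟨β₁, hβ₁, rfl⟩, ⟨α₁, hα₁, rfl⟩, _, h2⟩
  rw [Set.mem_preimage]
  dsimp only at e₁ ⊢
  rw [mul_mk]
  exact h2

end Germ

variable (F) in
/-- The groupoid of germs. -/
noncomputable abbrev germGroupoid : EtaleGroupoid.{u} where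
  Obj := F.CodeSpace
  Arr := F.Germ
  r := Germ.r
  s := Germ.s
  mul := Germ.mul
  unit := Germ.unit
  inv := Germ.inv
  r_mul := Germ.r_mul
  s_mul := Germ.s_mul
  mul_assoc := Germ.mul_assoc
  r_unit := Germ.r_unit
  s_unit _ := rfl
  unit_mul := Germ.unit_mul
  mul_unit := Germ.mul_unit
  r_inv := Germ.r_inv
  s_inv := Germ.s_inv
  inv_mul := Germ.inv_mul
  mul_inv := Germ.mul_inv
  continuous_mul := Germ.continuous_mul
  continuous_unit := Germ.continuous_unit
  continuous_inv := Germ.continuous_inv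
  isLocalHomeomorph_r := Germ.isLocalHomeomorph_r
  isLocalHomeomorph_s := Germ.isLocalHomeomorph_s

end CorrespondenceDiagram

/-! ### Cancellation and the canonical action -/

namespace EtaleGroupoid.LeftAction

variable {G : EtaleGroupoid.{u}} {Y : Type u} [TopologicalSpace Y] (a : G.LeftAction Y)

theorem act_congr {g g' : G.Arr} {y y' : Y} (hg : g = g') (hy : y = y') (e : G.s g = a.anchor y)
    (e' : G.s g' = a.anchor y') : a.act g y e = a.act g' y' e' := by
  subst hg hy; rfl

theorem act_unit' {y : Y} {g : G.Arr} {b : G.Obj} (hg : g = G.unit b) (e : G.s g = a.anchor y) :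
    a.act g y e = y := by
  subst hg
  obtain rfl : b = a.anchor y := (G.s_unit b).symm.trans e
  exact a.unit_act y

theorem act_inv_act (g : G.Arr) (y : Y) (e : G.s g = a.anchor y)
    (e' : G.s (G.inv g) = a.anchor (a.act g y e)) : a.act (G.inv g) (a.act g y e) e' = y := by
  rw [← a.mul_act (G.inv g) g y (G.s_inv g) e]
  exact a.act_unit' (G.inv_mul g) _

theorem act_act_inv (g : G.Arr) (y : Y) (e : G.s (G.inv g) = a.anchor y)
    (e' : G.s g = a.anchor (a.act (G.inv g) y e)) : a.act g (a.act (G.inv g) y e) e' = y := by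
  rw [← a.mul_act g (G.inv g) y (G.r_inv g).symm e]
  exact a.act_unit' (G.mul_inv g) _

theorem eq_of_act_eq {g : G.Arr} {y y' : Y} {e : G.s g = a.anchor y} {e' : G.s g = a.anchor y'}
    (h : a.act g y e = a.act g y' e') : y = y' := by
  have h1 := (G.s_inv g).trans (a.anchor_act g y e).symm
  have h2 := (G.s_inv g).trans (a.anchor_act g y' e').symm
  rw [← a.act_inv_act g y e h1, ← a.act_inv_act g y' e' h2]
  exact a.act_congr rfl h _ _

theorem ext_of_act_eq {a a' : G.LeftAction Y} (h : ∀ y, a.anchor y = a'.anchor y)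
    (h' : ∀ g y e e', a.act g y e = a'.act g y e') : a = a' := by
  obtain ⟨p, q, _, _, _, _, _⟩ := a
  obtain ⟨p', q', _, _, _, _, _⟩ := a'
  obtain rfl : p = p' := funext h
  obtain rfl : q = q' := by
    funext g y e
    exact h' g y e e
  rfl

/-- The canonical action of a groupoid on its space of objects. -/
def canonical (G : EtaleGroupoid.{u}) : G.LeftAction G.Obj where
  anchor := id
  act g _ _ := G.r g
  anchor_act _ _ _ := rfl
  mul_act g h _ e _ := G.r_mul g h e
  unit_act y := G.r_unit y
  continuous_anchor := continuous_id
  continuous_act := G.isLocalHomeomorph_r.continuous.comp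
    (continuous_fst.comp continuous_subtype_val)

/-- An equivariant map to the canonical action must preserve anchors, so it can only be the anchor
map: the canonical action is terminal. -/
theorem isEquivariant_anchor : a.IsEquivariant (canonical G) a.anchor :=
  ⟨a.continuous_anchor, fun _ => rfl, fun g y e => a.anchor_act g y e⟩

end EtaleGroupoid.LeftAction

/-! ### From `F`-actions to actions of the groupoid of germs -/

namespace CorrespondenceDiagram

variable {C : Type u} [SmallCategory C] {F : CorrespondenceDiagram C}

namespace Action

variable {Y : Type u} [TopologicalSpace Y]

theorem ext_of_act_eq {a a' : F.Action Y} (h : ∀ y, a.anchor y = a'.anchor y)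
    (h' : ∀ {x x' : C} (g : x ⟶ x') γ y e e', a.act g γ y e = a'.act g γ y e') : a = a' := by
  obtain ⟨p, _, q, _, _, _, _, _, _⟩ := a
  obtain ⟨p', _, q', _, _, _, _, _, _⟩ := a'
  obtain rfl : p = p' := funext h
  obtain rfl : @q = @q' := by
    funext x x' g γ y e
    exact h' g γ y e e
  rfl

theorem step_iff {a : F.Action Y} {S : F.Slice} {γ : F.X S.hom} (hγ : γ ∈ S.carrier) {y z : Y}
    (e : a.anchor y = ⟨S.dom, (F.X S.hom).s γ⟩) : a.Step S y z ↔ a.act S.hom γ y e = z :=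
  ⟨fun h => Step.right_unique ⟨γ, hγ, e, rfl⟩ h, fun h => ⟨γ, hγ, e, h⟩⟩

theorem wordRel_singleton_true {a : F.Action Y} {S : F.Slice} {y z : Y} :
    a.WordRel [(true, S)] y z ↔ a.Step S y z :=
  wordRel_singleton

/-- Words with the same germ at a code agree on all points of `Y` with that code, by the choice of
`Agree`. -/
theorem exists_act_germ (a : F.Action Y) (g : F.Germ) (y : Y) (e : g.s = a.toCode y) :
    ∃ z, ∀ w α h, Germ.mk w α h = g → a.WordRel w y z := by
  obtain ⟨w, α, ⟨β, h⟩, rfl⟩ := g.exists_mk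
  obtain rfl : α = a.toCode y := e
  obtain ⟨z, h1, -⟩ := exists_wordRel_of_toCode h
  refine ⟨z, fun w' α' h' h2 => ?_⟩
  obtain ⟨rfl, h3⟩ := Germ.mk_eq_iff.mp h2
  exact (h3.self_of_nhds Y a y z rfl).mpr h1

/-- The action of a germ on a point of an `F`-action. -/
noncomputable def actGerm (a : F.Action Y) (g : F.Germ) (y : Y) (e : g.s = a.toCode y) : Y :=
  (a.exists_act_germ g y e).choose

theorem wordRel_actGerm (a : F.Action Y) (w : F.SliceWord) (α : F.CodeSpace) (h : α ∈ w.dom)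
    (y : Y) (e : (Germ.mk w α h).s = a.toCode y) : a.WordRel w y (a.actGerm (.mk w α h) y e) :=
  (a.exists_act_germ _ y e).choose_spec w α h rfl

theorem actGerm_eq {a : F.Action Y} {w : F.SliceWord} {α : F.CodeSpace} {h : α ∈ w.dom}
    {y z : Y} (hw : a.WordRel w y z) (e : (Germ.mk w α h).s = a.toCode y) :
    a.actGerm (.mk w α h) y e = z :=
  (a.wordRel_actGerm w α h y e).right_unique hw

theorem toCode_actGerm (a : F.Action Y) (g : F.Germ) (y : Y) (e : g.s = a.toCode y) :
    a.toCode (a.actGerm g y e) = g.r := by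
  obtain ⟨w, α, h, rfl⟩ := g.exists_mk
  have h1 := (a.wordRel_actGerm w α h y e).toCode
  rw [← show α = a.toCode y from e] at h1
  exact h1.right_unique (Germ.wordRel_r w α h)

/-- The action of the groupoid of germs on an `F`-action. -/
noncomputable def germAction (a : F.Action Y) : F.germGroupoid.LeftAction Y where
  anchor := a.toCode
  act := a.actGerm
  anchor_act := a.toCode_actGerm
  mul_act := by
    intro g h y e e'
    have e'' := e.trans (a.toCode_actGerm h y e').symm
    obtain ⟨w', β, hβ, rfl⟩ := Germ.exists_mk g
    obtain ⟨w, α, hα, rfl⟩ := Germ.exists_mk h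
    have h1 : a.WordRel (w ++ w') y _ := wordRel_append.mpr
      ⟨_, a.wordRel_actGerm w α hα y e', a.wordRel_actGerm w' β hβ _ e''⟩
    have key : ∀ k (hk : k = Germ.mk (w ++ w') α (Germ.append_mem_dom hα hβ e)) (ek : k.s = _),
        a.actGerm k y ek = a.actGerm (Germ.mk w' β hβ) (a.actGerm (Germ.mk w α hα) y e') e'' := by
      rintro _ rfl ek
      exact actGerm_eq h1 ek
    exact key _ (Germ.mul_mk hα hβ e) _
  unit_act y := actGerm_eq (w := []) rfl _
  continuous_anchor := a.isEquivariant_toCode.1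
  continuous_act := by
    refine continuous_def.mpr fun O hO => isOpen_iff_mem_nhds.mpr ?_
    rintro ⟨⟨g, y⟩, e⟩ hgy
    obtain ⟨w, α, hα, rfl⟩ := Germ.exists_mk g
    have h1 := ((Germ.isOpen_bisection w).prod (a.isOpen_wordRel w hO)).preimage
      (continuous_subtype_val (p := fun p : F.Germ × Y => p.1.s = a.toCode p.2))
    filter_upwards [h1.mem_nhds (show (⟨(Germ.mk w α hα, y), e⟩ :
      {p : F.Germ × Y // p.1.s = a.toCode p.2}) ∈ _ from
        ⟨⟨α, hα, rfl⟩, _, hgy, a.wordRel_actGerm w α hα y e⟩)]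
    rintro ⟨⟨_, y'⟩, e'⟩ ⟨⟨α', hα', rfl⟩, z, hz, h2⟩
    have h3 : a.actGerm (Germ.mk w α' hα') y' e' ∈ O := by rwa [actGerm_eq h2 e']
    exact h3

end Action

namespace Germ

theorem mem_dom_of_step {S : F.Slice} {γ : F.X S.hom} (hγ : γ ∈ S.carrier) {α : F.CodeSpace}
    (e : α.anchor = ⟨S.dom, (F.X S.hom).s γ⟩) : α ∈ SliceWord.dom [(true, S)] :=
  ⟨_, (Action.wordRel_singleton_true (a := CodeSpace.action F) (y := α)).mpr ⟨γ, hγ, e, rfl⟩⟩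

/-- The germ at `α` of the multiplication by `γ`. -/
noncomputable def ofPoint {x x' : C} (g : x ⟶ x') (γ : F.X g) (α : F.CodeSpace)
    (e : α.anchor = ⟨x, (F.X g).s γ⟩) : F.Germ :=
  mk [(true, sliceAt g γ)] α (mem_dom_of_step (mem_sliceAt g γ) e)

theorem r_ofPoint {x x' : C} (g : x ⟶ x') (γ : F.X g) (α : F.CodeSpace)
    (e : α.anchor = ⟨x, (F.X g).s γ⟩) : (ofPoint g γ α e).r = CodeSpace.act g γ α e :=
  r_mk ((Action.wordRel_singleton_true (a := CodeSpace.action F) (y := α)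
    (S := sliceAt g γ)).mpr ⟨γ, mem_sliceAt g γ, e, rfl⟩)

/-- Two slices through `γ` share a neighbourhood of `γ`. As `s` is open, all codes near `α` are
acted upon by arrows in the intersection. -/
theorem mk_eq_ofPoint {S : F.Slice} {γ : F.X S.hom} (hγ : γ ∈ S.carrier) {α : F.CodeSpace}
    (h : α ∈ SliceWord.dom [(true, S)]) (e : α.anchor = ⟨S.dom, (F.X S.hom).s γ⟩) :
    mk [(true, S)] α h = ofPoint S.hom γ α e := by
  refine mk_eq_iff.mpr ⟨rfl, ?_⟩
  have h1 : IsOpen (S.carrier ∩ (sliceAt S.hom γ).carrier) :=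
    S.isOpen.inter (sliceAt S.hom γ).isOpen
  have h2 := (((F.isOpenEmbedding_mk S.dom).isOpenMap.comp
    (CorrespondenceDiagram.isOpenMap_s S.hom)) _ h1).preimage
    (CodeSpace.continuous_anchor (F := F))
  filter_upwards [h2.mem_nhds ⟨γ, ⟨hγ, mem_sliceAt S.hom γ⟩, e.symm⟩]
  rintro _ ⟨γ', ⟨h3, h4⟩, h5⟩ Y _ a y z rfl
  rw [CodeSpace.anchor_toCode] at h5
  rw [Action.wordRel_singleton_true, Action.wordRel_singleton_true, Action.step_iff h3 h5.symm]
  exact (Action.step_iff (S := sliceAt S.hom γ) h4 h5.symm).symm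

theorem mul_ofPoint {x y z : C} (g : y ⟶ z) (h : x ⟶ y) (k : x ⟶ z) (hk : h ≫ g = k)
    (γ₁ : F.X g) (γ₂ : F.X h) (α : F.CodeSpace) (e : (F.X g).s γ₁ = (F.X h).r γ₂)
    (e' : α.anchor = ⟨x, (F.X h).s γ₂⟩) (e₁ : (CodeSpace.act h γ₂ α e').anchor = ⟨y, (F.X g).s γ₁⟩)
    (e₂ : α.anchor = ⟨x, (F.X k).s (F.mul g h k hk (.mk γ₁ γ₂ e))⟩)
    (e₃ : (ofPoint g γ₁ _ e₁).s = (ofPoint h γ₂ α e').r) :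
    mul (ofPoint g γ₁ _ e₁) (ofPoint h γ₂ α e') e₃ = ofPoint k _ α e₂ := by
  refine (mul_mk _ _ e₃).trans (mk_eq_iff.mpr ⟨rfl, ?_⟩)
  let γ₃ := F.mul g h k hk (.mk γ₁ γ₂ e)
  have hc : Continuous fun p : {p : F.X g × F.X h // (F.X h).r p.2 = (F.X g).s p.1} =>
      F.mul g h k hk (.mk p.1.1 p.1.2 p.2.symm) :=
    (F.mul g h k hk).continuous.comp
      (continuous_quotient_mk'.comp (continuous_subtype_val.subtype_mk fun p => p.2.symm))
  have h1 := (((sliceAt g γ₁).isOpen.prod (sliceAt h γ₂).isOpen).preimage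
    (continuous_subtype_val (p := fun p : F.X g × F.X h => (F.X h).r p.2 = (F.X g).s p.1))).inter
    ((sliceAt k γ₃).isOpen.preimage hc)
  -- Openness of both source maps lets every code near `α` be multiplied by a pair in the two slices
  -- whose product lies in the slice of `γ₃`.
  have h2 := isOpenMap_snd_pullback (continuous_r h) (CorrespondenceDiagram.isOpenMap_s g) _ h1
  have h3 := (((F.isOpenEmbedding_mk x).isOpenMap.comp
    (CorrespondenceDiagram.isOpenMap_s h)) _ h2).preimage
    (CodeSpace.continuous_anchor (F := F))
  filter_upwards [h3.mem_nhds ⟨γ₂, ⟨⟨(γ₁, γ₂), e.symm⟩,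
    ⟨⟨mem_sliceAt g γ₁, mem_sliceAt h γ₂⟩, mem_sliceAt k γ₃⟩, rfl⟩, e'.symm⟩]
  rintro _ ⟨_, ⟨⟨⟨γ₁', γ₂'⟩, e₄⟩, ⟨⟨h4, h5⟩, h6⟩, rfl⟩, h7⟩ Y _ a w t rfl
  rw [CodeSpace.anchor_toCode] at h7
  have e₅ : a.anchor w = ⟨x, (F.X k).s (F.mul g h k hk (.mk γ₁' γ₂' e₄.symm))⟩ :=
    h7.symm.trans (congrArg (Sigma.mk x) (F.s_mul g h k hk _ _ e₄.symm).symm)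
  rw [Action.wordRel_append]
  simp only [Action.wordRel_singleton_true]
  refine Iff.trans ?_ (Action.step_iff (S := sliceAt k γ₃) h6 e₅).symm
  refine Iff.trans ?_ (Eq.congr_left (a.mul_act g h k hk γ₁' γ₂' w e₄.symm h7.symm))
  have e₆ := (a.anchor_act h γ₂' w h7.symm).trans (congrArg (Sigma.mk y) e₄)
  constructor
  · rintro ⟨t', h8, h9⟩
    obtain rfl := (Action.step_iff (S := sliceAt h γ₂) h5 h7.symm).mp h8
    exact (Action.step_iff (S := sliceAt g γ₁) h4 e₆).mp h9
  · rintro rfl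
    exact ⟨_, (Action.step_iff (S := sliceAt h γ₂) h5 h7.symm).mpr rfl,
      (Action.step_iff (S := sliceAt g γ₁) h4 e₆).mpr rfl⟩

end Germ

/-! ### From actions of the groupoid of germs to `F`-actions -/

section OfGermAction

variable {Y : Type u} [TopologicalSpace Y] (b : F.germGroupoid.LeftAction Y)

/-- The action of a word on a space with an action of the groupoid of germs, as a relation. -/
def GermWordRel (w : F.SliceWord) (y z : Y) : Prop :=
  ∃ h : b.anchor y ∈ w.dom, b.act (.mk w (b.anchor y) h) y rfl = z

variable {b}

theorem GermWordRel.inv {w : F.SliceWord} {y z : Y} (h : GermWordRel b w y z) :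
    GermWordRel b w.inv z y := by
  obtain ⟨h, rfl⟩ := h
  have h1 : b.anchor (b.act (.mk w (b.anchor y) h) y rfl) = (Germ.mk w (b.anchor y) h).r :=
    b.anchor_act _ _ _
  refine ⟨h1.symm ▸ Germ.r_mem_dom_inv w _ h, ?_⟩
  refine Eq.trans (b.act_congr ?_ rfl _ (Germ.s_inv _ |>.trans h1.symm))
    (b.act_inv_act (Germ.mk w (b.anchor y) h) y rfl (Germ.s_inv _ |>.trans h1.symm))
  exact Germ.mk_congr _ _ rfl h1

theorem germWordRel_inv {w : F.SliceWord} {y z : Y} :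
    GermWordRel b w.inv y z ↔ GermWordRel b w z y :=
  ⟨fun h => by simpa only [SliceWord.inv_inv] using h.inv, fun h => h.inv⟩

theorem GermWordRel.append {w w' : F.SliceWord} {y z t : Y} (h : GermWordRel b w y z)
    (h' : GermWordRel b w' z t) : GermWordRel b (w ++ w') y t := by
  obtain ⟨h, rfl⟩ := h
  obtain ⟨h', rfl⟩ := h'
  have e := b.anchor_act (.mk w (b.anchor y) h) y rfl
  refine ⟨Germ.append_mem_dom h h' e, ?_⟩
  exact Eq.trans
    (b.act_congr (Germ.mul_mk h h' e).symm rfl _ (Germ.s_mul (.mk w' _ h') (.mk w _ h) e))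
    (b.mul_act (.mk w' _ h') (.mk w _ h) y e rfl)

theorem germWordRel_nil (y : Y) : GermWordRel b [] y y :=
  ⟨⟨_, rfl⟩, b.unit_act y⟩

variable (b)

theorem isOpen_germWordRel (w : F.SliceWord) {O : Set Y} (hO : IsOpen O) :
    IsOpen {y | ∃ z ∈ O, GermWordRel b w y z} := by
  have hD : IsOpen {y | b.anchor y ∈ w.dom} := w.isOpen_dom.preimage b.continuous_anchor
  have h1 : Continuous fun y : {y | b.anchor y ∈ w.dom} => Germ.mk w (b.anchor y.1) y.2 :=
    (Germ.continuous_mk w).comp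
      ((b.continuous_anchor.comp continuous_subtype_val).subtype_mk fun y => y.2)
  have h2 : Continuous fun y : {y | b.anchor y ∈ w.dom} =>
      b.act (.mk w (b.anchor y.1) y.2) y.1 rfl :=
    b.continuous_act.comp ((h1.prodMk continuous_subtype_val).subtype_mk fun _ => rfl)
  convert hD.isOpenMap_subtype_val _ (hO.preimage h2) using 1
  ext y
  constructor
  · rintro ⟨_, hz, h, rfl⟩
    exact ⟨⟨y, h⟩, hz, rfl⟩
  · rintro ⟨⟨y, h⟩, hz, rfl⟩
    exact ⟨_, hz, h, rfl⟩

/-- The multiplication of the `F`-action defined by an action of the groupoid of germs. -/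
noncomputable def pointAct {x x' : C} (g : x ⟶ x') (γ : F.X g) (y : Y)
    (e : CodeSpace.anchor (b.anchor y) = ⟨x, (F.X g).s γ⟩) : Y :=
  b.act (Germ.ofPoint g γ (b.anchor y) e) y rfl

theorem anchor_pointAct {x x' : C} (g : x ⟶ x') (γ : F.X g) (y : Y)
    (e : CodeSpace.anchor (b.anchor y) = ⟨x, (F.X g).s γ⟩) :
    b.anchor (pointAct b g γ y e) = CodeSpace.act g γ (b.anchor y) e :=
  (b.anchor_act _ _ _).trans (Germ.r_ofPoint g γ _ e)

theorem pointAct_congr {x x' : C} {g : x ⟶ x'} {γ γ' : F.X g} {y y' : Y} (hγ : γ = γ')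
    (hy : y = y') (e : CodeSpace.anchor (b.anchor y) = ⟨x, (F.X g).s γ⟩)
    (e' : CodeSpace.anchor (b.anchor y') = ⟨x, (F.X g).s γ'⟩) :
    pointAct b g γ y e = pointAct b g γ' y' e' := by
  subst hγ hy; rfl

theorem exists_pointAct_iff {S : F.Slice} {y z : Y} :
    (∃ γ ∈ S.carrier, ∃ e, pointAct b S.hom γ y e = z) ↔ GermWordRel b [(true, S)] y z := by
  constructor
  · rintro ⟨γ, hγ, e, rfl⟩
    exact ⟨Germ.mem_dom_of_step hγ e, b.act_congr (Germ.mk_eq_ofPoint hγ _ e) rfl _ _⟩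
  · rintro ⟨h, rfl⟩
    obtain ⟨β, hβ⟩ := id h
    obtain ⟨γ, hγ, e, -⟩ := Action.wordRel_singleton_true.mp hβ
    exact ⟨γ, hγ, e, (b.act_congr (Germ.mk_eq_ofPoint hγ h e) rfl _ _).symm⟩

theorem pointAct_mul {x y z : C} (g : y ⟶ z) (h : x ⟶ y) (k : x ⟶ z) (hk : h ≫ g = k)
    (γ₁ : F.X g) (γ₂ : F.X h) (w : Y) (e : (F.X g).s γ₁ = (F.X h).r γ₂)
    (e' : CodeSpace.anchor (b.anchor w) = ⟨x, (F.X h).s γ₂⟩)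
    (e₁ : CodeSpace.anchor (b.anchor (pointAct b h γ₂ w e')) = ⟨y, (F.X g).s γ₁⟩)
    (e₂ : CodeSpace.anchor (b.anchor w) = ⟨x, (F.X k).s (F.mul g h k hk (.mk γ₁ γ₂ e))⟩) :
    pointAct b g γ₁ (pointAct b h γ₂ w e') e₁ =
      pointAct b k (F.mul g h k hk (.mk γ₁ γ₂ e)) w e₂ := by
  have h1 := anchor_pointAct b h γ₂ w e'
  have e₃ : CodeSpace.anchor (CodeSpace.act h γ₂ (b.anchor w) e') = ⟨y, (F.X g).s γ₁⟩ :=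
    h1 ▸ e₁
  have e₄ := (Germ.r_ofPoint h γ₂ (b.anchor w) e').symm
  have h2 : Germ.ofPoint g γ₁ _ e₁ = Germ.ofPoint g γ₁ _ e₃ := Germ.mk_congr _ _ rfl h1
  refine (b.act_congr h2 rfl _ h1.symm).trans ?_
  refine (b.mul_act (Germ.ofPoint g γ₁ _ e₃) (Germ.ofPoint h γ₂ (b.anchor w) e') w e₄
    rfl).symm.trans ?_
  exact b.act_congr (Germ.mul_ofPoint g h k hk γ₁ γ₂ _ e e' e₃ e₂ e₄) rfl _ _

/-- The `F`-action defined by an action of the groupoid of germs. -/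
noncomputable def ofGermAction : F.Action Y where
  anchor y := CodeSpace.anchor (b.anchor y)
  continuous_anchor := CodeSpace.continuous_anchor.comp b.continuous_anchor
  act := pointAct b
  anchor_act g γ y e := by
    rw [anchor_pointAct]
    exact (CodeSpace.action F).anchor_act g γ _ e
  continuous_act g := continuous_of_slices (act := pointAct b g) fun S hS h1 h2 O hO => by
    convert isOpen_germWordRel b [(true, ⟨g, S, hS, h1, h2⟩)] hO using 1
    ext y
    constructor
    · rintro ⟨γ, hγ, e, h⟩
      exact ⟨_, h, (exists_pointAct_iff b).mp ⟨γ, hγ, e, rfl⟩⟩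
    · rintro ⟨z, hz, h⟩
      obtain ⟨γ, hγ, e, rfl⟩ := (exists_pointAct_iff b).mpr h
      exact ⟨γ, hγ, e, hz⟩
  isOpenMap_act g := isOpenMap_of_slices (act := pointAct b g) fun S hS h1 h2 O hO => by
    convert isOpen_germWordRel b (SliceWord.inv [(true, ⟨g, S, hS, h1, h2⟩)]) hO using 1
    ext z
    simp only [germWordRel_inv, ← exists_pointAct_iff]
  surjective_act := by
    intro x x' g y' hx
    -- Factor the anchor of `y'` in the universal action, then apply the inverse germ to `y'`.
    obtain ⟨γ, α, e, h⟩ := (CodeSpace.action F).surjective_act g (b.anchor y') hx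
    have e₁ : (Germ.ofPoint g γ α e).inv.s = b.anchor y' :=
      (Germ.s_inv _).trans ((Germ.r_ofPoint g γ α e).trans h)
    have e₂ : b.anchor (b.act (Germ.ofPoint g γ α e).inv y' e₁) = α :=
      (b.anchor_act _ _ _).trans (Germ.r_inv (Germ.ofPoint g γ α e))
    refine ⟨γ, b.act (Germ.ofPoint g γ α e).inv y' e₁, e₂.symm ▸ e, ?_⟩
    refine Eq.trans (b.act_congr (g' := Germ.ofPoint g γ α e) ?_ rfl _ e₂.symm)
      (b.act_act_inv (Germ.ofPoint g γ α e) y' e₁ e₂.symm)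
    exact Germ.mk_congr _ _ rfl e₂
  mul_act g h k hk γ₁ γ₂ w e e' := pointAct_mul b g h k hk γ₁ γ₂ w e e' _ _
  exists_of_act_eq := by
    intro x x' g γ γ' y y' e e' h
    have h1 := congrArg b.anchor h
    rw [anchor_pointAct, anchor_pointAct] at h1
    -- The arrow `η` is found on anchors; the equality in `Y` then follows because the germ of `γ`
    -- acts injectively.
    obtain ⟨η, h2, h3, rfl, h4⟩ := CodeSpace.exists_of_act_eq g γ γ' _ _ e e' h1
    refine ⟨η, h2, h3, rfl, ?_⟩
    have h5 : b.anchor (pointAct b (𝟙 x) (F.one x η) y' h3) = b.anchor y :=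
      (anchor_pointAct b _ _ _ _).trans h4.symm
    have h6 := pointAct_mul b g (𝟙 x) g (Category.id_comp g) γ (F.one x η) y'
      (h2.trans (F.r_one x η).symm) h3 (h5 ▸ e)
      (by rw [F.mul_one g γ η h2]; exact e')
    rw [pointAct_congr b (F.mul_one g γ η h2) rfl _ e', ← h] at h6
    refine b.eq_of_act_eq (g := Germ.ofPoint g γ (b.anchor y) e) (e := rfl) (e' := h5.symm) ?_
    exact h6.symm.trans (b.act_congr (Germ.mk_congr _ _ rfl h5) rfl _ _)

theorem germWordRel_of_wordRel {w : F.SliceWord} {y z : Y} (h : (ofGermAction b).WordRel w y z) :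
    GermWordRel b w y z := by
  induction w generalizing y with
  | nil =>
    obtain rfl : y = z := h
    exact germWordRel_nil y
  | cons l w ih =>
    obtain ⟨t, h1, h2⟩ := h
    refine GermWordRel.append (w := [l]) ?_ (ih h2)
    obtain ⟨_ | _, S⟩ := l
    · exact GermWordRel.inv ((exists_pointAct_iff b).mp h1)
    · exact (exists_pointAct_iff b).mp h1

theorem isEquivariant_anchor_ofGermAction :
    (ofGermAction b).IsEquivariant (CodeSpace.action F) b.anchor :=
  ⟨b.continuous_anchor, fun _ => rfl, fun g γ y e => anchor_pointAct b g γ y e⟩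

/-- The anchor map is equivariant into the universal action, so it must be the code map. Hence the
original anchors are recovered. -/
theorem toCode_ofGermAction (y : Y) : (ofGermAction b).toCode y = b.anchor y := by
  rw [← (isEquivariant_anchor_ofGermAction b).toCode_eq y, Action.toCode_action]

theorem germAction_ofGermAction : (ofGermAction b).germAction = b := by
  refine EtaleGroupoid.LeftAction.ext_of_act_eq (toCode_ofGermAction b) fun g y e e' => ?_
  obtain ⟨w, α, h, rfl⟩ := Germ.exists_mk g
  obtain ⟨h1, h2⟩ := germWordRel_of_wordRel b ((ofGermAction b).wordRel_actGerm w α h y e)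
  exact h2.symm.trans (b.act_congr (Germ.mk_congr _ _ rfl (Eq.symm e')) rfl _ _)

theorem ofGermAction_germAction (a : F.Action Y) : ofGermAction a.germAction = a := by
  refine Action.ext_of_act_eq (fun y => CodeSpace.anchor_toCode a y) fun g γ y e e' => ?_
  exact Action.actGerm_eq (Action.wordRel_singleton_true.mpr (Action.step_sliceAt g γ y e')) rfl

end OfGermAction

/-! ### The groupoid model and uniqueness of universal actions -/

variable (F) in
/-- Actions of the groupoid of germs correspond to `F`-actions. -/
noncomputable def germActionEquiv (Y : Type u) [TopologicalSpace Y] :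
    F.germGroupoid.LeftAction Y ≃ F.Action Y where
  toFun := ofGermAction
  invFun := Action.germAction
  left_inv := germAction_ofGermAction
  right_inv := ofGermAction_germAction

theorem IsEquivariant.ofGermAction {Y Y' : Type u} [TopologicalSpace Y] [TopologicalSpace Y']
    {b : F.germGroupoid.LeftAction Y} {b' : F.germGroupoid.LeftAction Y'} {φ : Y → Y'}
    (h : b.IsEquivariant b' φ) : (ofGermAction b).IsEquivariant (ofGermAction b') φ := by
  obtain ⟨hc, h1, h2⟩ := h
  refine ⟨hc, fun y => congrArg CodeSpace.anchor (h1 y), fun g γ y e => ?_⟩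
  exact (h2 _ _ _).trans (b'.act_congr (Germ.mk_congr _ _ rfl (h1 y).symm) rfl _ _)

theorem Action.IsEquivariant.germAction {Y Y' : Type u} [TopologicalSpace Y] [TopologicalSpace Y']
    {a : F.Action Y} {a' : F.Action Y'} {φ : Y → Y'} (h : a.IsEquivariant a' φ) :
    a.germAction.IsEquivariant a'.germAction φ := by
  refine ⟨h.1, h.toCode_eq, fun g y e => ?_⟩
  obtain ⟨w, α, hα, rfl⟩ := Germ.exists_mk g
  obtain ⟨z, h1, rfl⟩ := h.isBisimulation.exists_wordRel rfl (a.wordRel_actGerm w α hα y e)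
  exact (Action.actGerm_eq h1 (e.trans (h.toCode_eq y).symm)).symm

variable (F) in
theorem isGroupoidModel_germGroupoid : F.IsGroupoidModel F.germGroupoid := by
  refine ⟨fun Y _ => F.germActionEquiv Y, fun Y Y' _ _ b b' φ => ⟨IsEquivariant.ofGermAction, ?_⟩⟩
  intro h
  have h1 := Action.IsEquivariant.germAction h
  rwa [show (F.germActionEquiv Y b).germAction = b from germAction_ofGermAction b,
    show (F.germActionEquiv Y' b').germAction = b' from germAction_ofGermAction b'] at h1

/-- The natural bijection turns the terminal `U`-action, the canonical one on objects, into a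
terminal `F`-action. -/
theorem IsGroupoidModel.exists_isUniversal {U : EtaleGroupoid.{u}} (hU : F.IsGroupoidModel U) :
    ∃ ω : F.Action U.Obj, ω.IsUniversal := by
  obtain ⟨Φ, hΦ⟩ := hU
  refine ⟨Φ _ (.canonical U), fun Y _ a => ?_⟩
  obtain ⟨b, rfl⟩ := (Φ Y).surjective a
  refine ⟨b.anchor, (hΦ _ _ _ _ _).mp b.isEquivariant_anchor, fun φ h => funext fun y => ?_⟩
  exact ((hΦ _ _ _ _ _).mpr h).2.1 y

theorem Action.IsEquivariant.comp {Y Y' Y'' : Type u} [TopologicalSpace Y] [TopologicalSpace Y']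
    [TopologicalSpace Y''] {a : F.Action Y} {a' : F.Action Y'} {a'' : F.Action Y''} {φ : Y → Y'}
    {ψ : Y' → Y''} (hψ : a'.IsEquivariant a'' ψ) (hφ : a.IsEquivariant a' φ) :
    a.IsEquivariant a'' (ψ ∘ φ) := by
  obtain ⟨hc, h1, h2⟩ := hφ
  obtain ⟨hc', h1', h2'⟩ := hψ
  refine ⟨hc'.comp hc, fun y => (h1' _).trans (h1 y), fun g γ y e => ?_⟩
  exact (congrArg ψ (h2 g γ y e)).trans (h2' g γ _ _)

theorem Action.isEquivariant_id {Y : Type u} [TopologicalSpace Y] (a : F.Action Y) :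
    a.IsEquivariant a id :=
  ⟨continuous_id, fun _ => rfl, fun _ _ _ _ => rfl⟩

/-- Universal actions are unique up to an equivariant homeomorphism. -/
theorem Action.IsUniversal.exists_homeomorph {Ω Ω' : Type u} [TopologicalSpace Ω]
    [TopologicalSpace Ω'] {ω : F.Action Ω} {ω' : F.Action Ω'} (h : ω.IsUniversal)
    (h' : ω'.IsUniversal) : ∃ e : Ω ≃ₜ Ω', ∀ y, ω'.anchor (e y) = ω.anchor y := by
  obtain ⟨φ, hφ, -⟩ := h' Ω ω
  obtain ⟨ψ, hψ, -⟩ := h Ω' ω'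
  have h1 := (h Ω ω).unique (hψ.comp hφ) ω.isEquivariant_id
  have h2 := (h' Ω' ω').unique (hφ.comp hψ) ω'.isEquivariant_id
  exact ⟨⟨⟨φ, ψ, congrFun h1, congrFun h2⟩, hφ.1, hψ.1⟩, hφ.2.1⟩

theorem Action.IsUniversal.isProperMap_anchor (hp : F.IsProper) (hl : F.IsLocallyCompact)
    {Ω : Type u} [TopologicalSpace Ω] {ω : F.Action Ω} (h : ω.IsUniversal) :
    T2Space Ω ∧ LocallyCompactSpace Ω ∧ IsProperMap ω.anchor := by
  obtain ⟨e, he⟩ := h.exists_homeomorph (CodeSpace.isUniversal_action F)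
  have := CodeSpace.t2Space hp hl
  have h1 : T2Space Ω := e.isEmbedding.t2Space
  have h2 : IsProperMap ω.anchor := by
    rw [← show CodeSpace.anchor ∘ e = ω.anchor from funext he]
    exact (CodeSpace.isProperMap_anchor hp hl).comp e.isProperMap
  have h3 := weaklyLocallyCompactSpace_of_isProperMap hl h2
  exact ⟨h1, inferInstance, h2⟩

end CorrespondenceDiagram

theorem mainTheorem2 {C : Type u} [SmallCategory C] (F : CorrespondenceDiagram C)
    (hproper : F.IsProper) (hlc : F.IsLocallyCompact) :
    (∃ (Ω : Type u) (_ : TopologicalSpace Ω) (ω : F.Action Ω), ω.IsUniversal) ∧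
    (∀ (Ω : Type u) [TopologicalSpace Ω] (ω : F.Action Ω), ω.IsUniversal →
      T2Space Ω ∧ LocallyCompactSpace Ω ∧ IsProperMap ω.anchor) ∧
    (∃ U : EtaleGroupoid.{u}, F.IsGroupoidModel U) ∧
    (∀ U : EtaleGroupoid.{u}, F.IsGroupoidModel U → U.IsLocallyCompact) := by
  refine ⟨⟨_, _, _, CorrespondenceDiagram.CodeSpace.isUniversal_action F⟩,
    fun Ω _ ω h => h.isProperMap_anchor hproper hlc,
    ⟨_, CorrespondenceDiagram.isGroupoidModel_germGroupoid F⟩, fun U hU => ?_⟩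
  obtain ⟨ω, hω⟩ := hU.exists_isUniversal
  obtain ⟨h1, h2, -⟩ := hω.isProperMap_anchor hproper hlc
  exact ⟨h1, h2⟩
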